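/- Let $t\in\mathbb{C}\setminus\mathbb{Q}$, put $c=13-6(t+t^{-1})$, let $V_c$ be the universal Virasoro vertex operator algebra of central charge $c$, and for $\ell\in\mathbb{Z}_{\ge 0}$ let $\mathbb{W}_\ell$ be the simple quotient of the Verma module of central charge $c$ and highest weight $h_\ell=\frac{\ell(\ell+2)}{4}t-\frac{\ell}{2}$, regarded as a $V_c$-module, with highest weight vector $w_\ell$ (the image of the generator of the Verma module). For a $V_c$-module $W=\bigoplus_h W_{[h]}$, graded by the eigenvalues of $L_0$, write $\overline{W}=\prod_h W_{[h]}$, and let $\overline f$ denote the extension of a homomorphism $f$ to these completions. For $\ell_1,\ell_2\in\mathbb{Z}_{\ge 0}$ let $\mathrm{Sel}(\ell_1,\ell_2)$ be the set of integers $\ell$ with $|\ell_1-\ell_2|\le \ell\le \ell_1+\ell_2$ and $\ell+\ell_1+\ell_2$ even. For each $\ell\in\mathrm{Sel}(\ell_1,\ell_2)$ let $\mathcal{Y}_{\ell_1\ell_2}^{\ell}(-,x)$ be the intertwining operator of type $\binom{\mathbb{W}_\ell}{\mathbb{W}_{\ell_1}\,\mathbb{W}_{\ell_2}}$ normalized by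 $$\mathcal{Y}_{\ell_1\ell_2}^{\ell}(w_{\ell_1},x)w_{\ell_2}\in B_{\ell_1\ell_2}^{\ell}\,w_\ell\,x^{h_\ell-h_{\ell_1}-h_{\ell_2}}+\mathbb{W}_\ell[[x]]\,x^{h_\ell-h_{\ell_1}-h_{\ell_2}+1},$$ $$B_{\ell_1\ell_2}^{\ell}=\frac{1}{s!}\prod_{j=1}^{s}\frac{\Gamma(1+tj)\,\Gamma(1-t(\ell_1+1-j))\,\Gamma(1-t(\ell_2+1-j))}{\Gamma(1+t)\,\Gamma(2-t(2-j+\ell_1+\ell_2-s))},\qquad s=\frac{\ell_1+\ell_2-\ell}{2}.$$ For $z\in\mathbb{C}^\times$ let $\log z$ be the logarithm with $\arg z\in[0,2\pi)$. For every $z\in\mathbb{C}^\times$, realize the $P(z)$-tensor product as $$\mathbb{W}_{\ell_1}\boxtimes_{P(z)}\mathbb{W}_{\ell_2}=\bigoplus_{\ell\in\mathrm{Sel}(\ell_1,\ell_2)}\mathbb{W}_\ell,\qquad w_1\boxtimes_{P(z)}w_2=\mathcal{Y}_{\boxtimes}(w_1,x)w_2\big|_{x=e^{\log z}},\qquad \mathcal{Y}_{\boxtimes}=\sum_{\ell\in\mathrm{Sel}(\ell_1,\ell_2)}\mathcal{Y}_{\ell_1\ell_2}^{\ell},$$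 where the values lie in the completion of the direct sum, and $|_{x=e^{\zeta}}$ means that each power $x^\alpha$ is replaced by $e^{\alpha\zeta}$. Let $\gamma$ be a path in $\mathbb{C}^\times$ from $z_1$ to $z_2$, and let $l_\gamma(z_1)$ be the value at $z_1$ of the logarithm continued analytically along $\gamma$ from $\log z_2$. The parallel transport $\mathcal{T}_\gamma\colon \mathbb{W}_{\ell_1}\boxtimes_{P(z_1)}\mathbb{W}_{\ell_2}\to \mathbb{W}_{\ell_1}\boxtimes_{P(z_2)}\mathbb{W}_{\ell_2}$ is the homomorphism of $V_c$-modules characterized by $$\overline{\mathcal{T}_\gamma}\big(w_1\boxtimes_{P(z_1)}w_2\big)=\mathcal{Y}_{\boxtimes}(w_1,x)w_2\big|_{x=e^{l_\gamma(z_1)}},\qquad w_1\in\mathbb{W}_{\ell_1},\ w_2\in\mathbb{W}_{\ell_2}.$$ **Proposition.** Suppose that $\gamma$ does not change the branch, i.e. $\operatorname{Im} l_\gamma(z_1)$ equals the argument of $z_1$ in $[0,2\pi)$. Then there is exactly one homomorphism $\mathcal{T}_\gamma$ with this property, and it acts as $\mathrm{id}_{\mathbb{W}_\ell}$ on each component $\mathbb{W}_\ell$,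 $\ell\in\mathrm{Sel}(\ell_1,\ell_2)$. -/

import Mathlib

noncomputable section

namespace FirstRowVirasoro

attribute [local instance] LieRing.ofAssociativeRing

/-! ### The Virasoro algebra -/

/-- The underlying space of the Virasoro algebra `⨁ₙ ℂ Lₙ ⊕ ℂ C`. -/
def Vir : Type := (ℤ →₀ ℂ) × ℂ

instance : AddCommGroup Vir := inferInstanceAs (AddCommGroup ((ℤ →₀ ℂ) × ℂ))
instance : Module ℂ Vir := inferInstanceAs (Module ℂ ((ℤ →₀ ℂ) × ℂ))

namespace Vir

/-- The basis element `Lₙ`. -/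
def L (n : ℤ) : Vir := (Finsupp.single n 1, 0)

/-- The central element `C`. -/
def C : Vir := (0, 1)

/-- The bracket of the basis elements,
`[L_m, L_n] = (m - n) L_{m+n} + (m³ - m)/12 δ_{m+n,0} C`. -/
def basisBracket (m n : ℤ) : Vir :=
  ((m : ℂ) - n) • L (m + n) + (if m + n = 0 then ((m : ℂ) ^ 3 - m) / 12 else 0) • C

/-- The bilinear extension of `basisBracket`. -/
def bracketAux : (ℤ →₀ ℂ) →ₗ[ℂ] (ℤ →₀ ℂ) →ₗ[ℂ] Vir :=
  Finsupp.linearCombination ℂ fun m => Finsupp.linearCombination ℂ fun n => basisBracket m n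

/-- The bracket of the Virasoro algebra; `C` is central. -/
instance : Bracket Vir Vir := ⟨fun x y => bracketAux x.1 y.1⟩

theorem bracket_def (x y : Vir) : ⁅x, y⁆ = bracketAux x.1 y.1 := rfl

theorem bracketAux_single (m n : ℤ) (a b : ℂ) :
    bracketAux (Finsupp.single m a) (Finsupp.single n b) = (a * b) • basisBracket m n := by
  simp [bracketAux, smul_smul]

theorem basisBracket_fst (m n : ℤ) :
    (basisBracket m n).1 = Finsupp.single (m + n) ((m : ℂ) - n) := by
  have h : (basisBracket m n).1 = ((m : ℂ) - n) • (L (m + n)).1 +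
    (if m + n = 0 then ((m : ℂ) ^ 3 - m) / 12 else 0) • C.1 := rfl
  rw [h]
  simp [L, C]

theorem bracketAux_skew (a b : ℤ →₀ ℂ) : bracketAux a b = -bracketAux b a := by
  induction a using Finsupp.induction_linear with
  | zero => simp
  | add f g hf hg => simp only [map_add, LinearMap.add_apply, hf, hg, neg_add]
  | single m x =>
    induction b using Finsupp.induction_linear with
    | zero => simp
    | add f g hf hg => simp only [map_add, LinearMap.add_apply, hf, hg, neg_add]
    | single n y =>
      rw [bracketAux_single, bracketAux_single, ← smul_neg, mul_comm x y]
      congr 1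
      unfold basisBracket
      rw [add_comm n m, neg_add, ← neg_smul, ← neg_smul]
      congr 2
      · ring
      · split_ifs with h
        · have : (n : ℂ) = -m := by
            have : n = -m := by omega
            rw [this]; push_cast; ring
          rw [this]; ring
        · simp

theorem bracketAux_jacobi (a b d : ℤ →₀ ℂ) :
    bracketAux a (bracketAux b d).1 =
      bracketAux (bracketAux a b).1 d + bracketAux b (bracketAux a d).1 := by
  have fst_add : ∀ x y : Vir, (x + y).1 = x.1 + y.1 := fun _ _ => rfl
  have fst_smul : ∀ (r : ℂ) (y : Vir), (r • y).1 = r • y.1 := fun _ _ => rfl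
  have fst_zero : (0 : Vir).1 = 0 := rfl
  induction a using Finsupp.induction_linear with
  | zero => simp [fst_zero]
  | add f g hf hg => simp only [map_add, LinearMap.add_apply, hf, hg, fst_add]; abel
  | single m x =>
    induction b using Finsupp.induction_linear with
    | zero => simp [fst_zero]
    | add f g hf hg => simp only [map_add, LinearMap.add_apply, hf, hg, fst_add]; abel
    | single n y =>
      induction d using Finsupp.induction_linear with
      | zero => simp [fst_zero]
      | add f g hf hg => simp only [map_add, hf, hg, fst_add]; abel
      | single k z =>
        simp only [bracketAux_single, fst_smul, basisBracket_fst, Finsupp.smul_single]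
        unfold basisBracket
        simp only [smul_add, smul_smul]
        rw [show m + (n + k) = m + n + k by ring, show n + (m + k) = m + n + k by ring]
        rw [add_add_add_comm, ← add_smul, ← add_smul]
        congr 2
        · push_cast; simp only [smul_eq_mul]; ring
        · simp only [smul_eq_mul]
          split_ifs with h
          · have : (k : ℂ) = -m - n := by
              have : k = -m - n := by omega
              rw [this]; push_cast; ring
            push_cast
            rw [this]; ring
          · simp

instance : LieRing Vir where
  add_lie x y z := by
    simp only [bracket_def]; change bracketAux (x.1 + y.1) z.1 = _; simp
  lie_add x y z := by
    simp only [bracket_def]; change bracketAux x.1 (y.1 + z.1) = _; simp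
  lie_self x := by
    have h := bracketAux_skew x.1 x.1
    rw [bracket_def]
    have h2 : (2 : ℂ) • bracketAux x.1 x.1 = 0 := by
      rw [two_smul]; nth_rewrite 1 [h]; simp
    exact (smul_eq_zero.1 h2).resolve_left two_ne_zero
  leibniz_lie x y z := by
    simp only [bracket_def]; exact bracketAux_jacobi x.1 y.1 z.1

instance : LieAlgebra ℂ Vir where
  lie_smul r x y := by
    simp only [bracket_def]; change bracketAux x.1 (r • y.1) = _; simp

end Vir

/-- The universal enveloping algebra `U(vir)`. -/
abbrev UVir : Type := UniversalEnvelopingAlgebra ℂ Vir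

/-- `Lₙ` as an element of `U(vir)`. -/
def uL (n : ℤ) : UVir := UniversalEnvelopingAlgebra.ι ℂ (Vir.L n)

/-- `C` as an element of `U(vir)`. -/
def uC : UVir := UniversalEnvelopingAlgebra.ι ℂ Vir.C

theorem uL_comm (m n : ℤ) : uL m * uL n - uL n * uL m = ((m : ℂ) - n) • uL (m + n) +
    (if m + n = 0 then ((m : ℂ) ^ 3 - m) / 12 else 0) • uC := by
  have h := (UniversalEnvelopingAlgebra.ι ℂ (L := Vir)).map_lie (Vir.L m) (Vir.L n)
  have h2 : ⁅Vir.L m, Vir.L n⁆ = Vir.basisBracket m n := by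
    rw [Vir.bracket_def, Vir.L, Vir.L, Vir.bracketAux_single]; simp
  rw [h2, Vir.basisBracket, map_add, map_smul, map_smul, LieRing.of_associative_ring_bracket] at h
  exact h.symm

theorem uC_comm (n : ℤ) : uC * uL n = uL n * uC := by
  have h := (UniversalEnvelopingAlgebra.ι ℂ (L := Vir)).map_lie Vir.C (Vir.L n)
  have h2 : ⁅Vir.C, Vir.L n⁆ = 0 := by
    rw [Vir.bracket_def, Vir.C]; simp
  rw [h2, map_zero, LieRing.of_associative_ring_bracket] at h
  exact (sub_eq_zero.1 h.symm)

theorem vir_mem_span (x : Vir) :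
    x = x.1.sum (fun n a => a • Vir.L n) + x.2 • Vir.C := by
  have h1 : ∀ f : ℤ →₀ ℂ, ((f, 0) : (ℤ →₀ ℂ) × ℂ) = f.sum (fun n a => a • Vir.L n) := by
    intro f
    induction f using Finsupp.induction_linear with
    | zero => rw [Finsupp.sum_zero_index]; rfl
    | add f g hf hg =>
      rw [Finsupp.sum_add_index' (by simp) (by intros; rw [add_smul]), ← hf, ← hg]
      change _ = ((f + g, 0 + 0) : (ℤ →₀ ℂ) × ℂ)
      simp
    | single n a =>
      rw [Finsupp.sum_single_index (by simp)]
      change _ = ((a • Finsupp.single n (1:ℂ), a • (0:ℂ)) : (ℤ →₀ ℂ) × ℂ)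
      simp
  rw [← h1]
  change x = ((x.1 + x.2 • 0, 0 + x.2 • 1) : (ℤ →₀ ℂ) × ℂ)
  simp
  rfl

/-- `U(vir)` is generated as an algebra by the `Lₙ` and `C`. -/
theorem uvir_induction {p : UVir → Prop} (hL : ∀ n u, p u → p (uL n * u))
    (hC : ∀ u, p u → p (uC * u)) (one : p 1)
    (add : ∀ u v, p u → p v → p (u + v)) (smul : ∀ (a : ℂ) u, p u → p (a • u)) (u : UVir) :
    p u := by
  have hι : ∀ (x : Vir) u, p u → p (UniversalEnvelopingAlgebra.ι ℂ x * u) := by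
    intro x u hu
    rw [vir_mem_span x, map_add, add_mul, map_smul, smul_mul_assoc]
    refine add _ _ ?_ (smul _ _ (hC _ hu))
    induction x.1 using Finsupp.induction_linear with
    | zero => rw [Finsupp.sum_zero_index, map_zero, zero_mul, ← zero_smul ℂ (1 : UVir)]
              exact smul _ _ one
    | add f g hf hg =>
      rw [Finsupp.sum_add_index' (by simp) (by intros; rw [add_smul]), map_add, add_mul]
      exact add _ _ hf hg
    | single n a =>
      rw [Finsupp.sum_single_index (by simp), map_smul, smul_mul_assoc]
      exact smul _ _ (hL _ _ hu)
  have hs : Function.Surjective (UniversalEnvelopingAlgebra.mkAlgHom ℂ Vir) := by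
    intro y
    exact RingCon.mkₐ_surjective (α := ℂ) (UniversalEnvelopingAlgebra.ringCon ℂ Vir) y
  have key : ∀ (z : TensorAlgebra ℂ Vir) u, p u →
      p (UniversalEnvelopingAlgebra.mkAlgHom ℂ Vir z * u) := by
    intro z
    induction z using TensorAlgebra.induction with
    | algebraMap r => intro u hu; rw [AlgHom.commutes, ← Algebra.smul_def]; exact smul _ _ hu
    | ι x => intro u hu; exact hι x u hu
    | mul a b ha hb => intro u hu; rw [map_mul, mul_assoc]; exact ha _ (hb _ hu)
    | add a b ha hb => intro u hu; rw [map_add, add_mul]; exact add _ _ (ha _ hu) (hb _ hu)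
  obtain ⟨z, rfl⟩ := hs u
  simpa using key z 1 one

/-! ### Smooth modules over the Virasoro algebra -/

/-- The operator by which `Lₙ` acts on a representation of the Virasoro algebra. -/
def Lop (W : Type*) [AddCommGroup W] [Module ℂ W] [Module UVir W] [IsScalarTower ℂ UVir W]
    (n : ℤ) : Module.End ℂ W :=
  Algebra.lsmul ℂ ℂ W (uL n)

/-- Representations of the Virasoro algebra of central charge `c` which are smooth
(each vector is annihilated by `Lₙ` for all large `n`) and on which `L₀` is diagonalizable:
the representations which carry vertex operators of the universal Virasoro VOA
and a weight decomposition. -/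
class IsSmoothVir (c : ℂ) (W : Type*) [AddCommGroup W] [Module ℂ W] [Module UVir W]
    [IsScalarTower ℂ UVir W] : Prop where
  central : ∀ w : W, uC • w = c • w
  smooth : ∀ w : W, ∃ N : ℕ, ∀ n : ℤ, (N : ℤ) ≤ n → Lop W n w = 0
  diagonalizable : ⨆ h : ℂ, Module.End.eigenspace (Lop W 0) h = ⊤

theorem Lop_apply {W : Type*} [AddCommGroup W] [Module ℂ W] [Module UVir W]
    [IsScalarTower ℂ UVir W] (n : ℤ) (w : W) : Lop W n w = uL n • w := rfl

theorem Lop_comm (c : ℂ) {W : Type*} [AddCommGroup W] [Module ℂ W] [Module UVir W]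
    [IsScalarTower ℂ UVir W] [IsSmoothVir c W] (m n : ℤ) (w : W) :
    Lop W m (Lop W n w) - Lop W n (Lop W m w) = ((m : ℂ) - n) • Lop W (m + n) w +
      (if m + n = 0 then ((m : ℂ) ^ 3 - m) / 12 * c else 0) • w := by
  simp only [Lop_apply, smul_smul, ← sub_smul, uL_comm, add_smul, smul_assoc,
    IsSmoothVir.central (c := c)]
  congr 1
  split_ifs <;> simp

/-! ### Binomial identities -/

/-- The generalized binomial coefficient `binom n j` for an integer `n`, as a complex number. -/
def binom (n : ℤ) (j : ℕ) : ℂ := (Ring.choose n j : ℤ)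

theorem binom_zero (n : ℤ) : binom n 0 = 1 := by simp [binom]

theorem binom_pred (x : ℤ) (k : ℕ) : ((x : ℂ) - k) * binom x k = x * binom (x - 1) k := by
  cases k with
  | zero => simp [binom]
  | succ k =>
    have h1 := Ring.choose_smul_choose (x : ℤ) (n := k + 1) (k := 1) (by omega)
    have h2 := Ring.choose_succ_succ (x - 1 : ℤ) k
    simp only [Nat.choose_one_right, nsmul_eq_mul, Ring.choose_one_right, Nat.cast_one,
      Nat.add_sub_cancel, sub_add_cancel] at h1 h2
    have h3 : ((x : ℤ) - (k + 1 : ℕ)) * Ring.choose x (k + 1) = x * Ring.choose (x - 1) (k + 1) := by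
      rw [sub_mul, h1, h2]; ring
    unfold binom
    exact_mod_cast h3

theorem binom_absorb (x : ℤ) (k : ℕ) : ((k + 1 : ℕ) : ℂ) * binom x (k + 1) =
    x * binom (x - 1) k := by
  have h1 := Ring.choose_smul_choose (x : ℤ) (n := k + 1) (k := 1) (by omega)
  simp only [Nat.choose_one_right, nsmul_eq_mul, Ring.choose_one_right, Nat.cast_one,
      Nat.add_sub_cancel] at h1
  unfold binom
  exact_mod_cast h1

theorem binom_vandermonde (x y : ℤ) (r : ℕ) :
    ∑ p ∈ Finset.HasAntidiagonal.antidiagonal r, binom x p.1 * binom y p.2 = binom (x + y) r := by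
  unfold binom
  rw [Ring.add_choose_eq r (Commute.all x y)]
  push_cast; rfl

theorem binom_sumA (m n : ℤ) (r : ℕ) :
    ∑ p ∈ Finset.HasAntidiagonal.antidiagonal r, binom (m + 1) p.1 * binom (n + 1) p.2 *
      (((m - p.1 : ℤ) : ℂ) - ((n - p.2 : ℤ) : ℂ)) = ((m : ℂ) - n) * binom (m + n + 1) r := by
  have h1 := binom_vandermonde m (n + 1) r
  have h2 := binom_vandermonde (m + 1) n r
  rw [show m + (n + 1) = m + n + 1 by ring] at h1
  rw [show m + 1 + n = m + n + 1 by ring] at h2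
  have e : ∀ p ∈ Finset.HasAntidiagonal.antidiagonal r, binom (m + 1) p.1 * binom (n + 1) p.2 *
      (((m - p.1 : ℤ) : ℂ) - ((n - p.2 : ℤ) : ℂ)) =
      ((m : ℂ) + 1) * (binom m p.1 * binom (n + 1) p.2) -
      ((n : ℂ) + 1) * (binom (m + 1) p.1 * binom n p.2) := by
    intro p _
    have a := binom_pred (m + 1) p.1
    have b := binom_pred (n + 1) p.2
    simp only [add_sub_cancel_right] at a b
    push_cast at a b ⊢
    linear_combination (binom (n + 1) p.2) * a - (binom (m + 1) p.1) * b
  rw [Finset.sum_congr rfl e, Finset.sum_sub_distrib, ← Finset.mul_sum, ← Finset.mul_sum, h1, h2]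
  ring

theorem binom_sumC (m n : ℤ) (r : ℕ) (hr : (r : ℤ) = m + n) :
    ∑ p ∈ Finset.HasAntidiagonal.antidiagonal r, binom (m + 1) p.1 * binom (n + 1) p.2 *
      (((m - p.1 : ℤ) : ℂ) ^ 3 - ((m - p.1 : ℤ) : ℂ)) =
      if r = 0 then (m : ℂ) ^ 3 - m else 0 := by
  have h1 := binom_vandermonde (m - 2) (n + 1) r
  rw [show m - 2 + (n + 1) = (r : ℤ) - 1 by omega] at h1
  have e : ∀ p ∈ Finset.HasAntidiagonal.antidiagonal r, binom (m + 1) p.1 * binom (n + 1) p.2 *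
      (((m - p.1 : ℤ) : ℂ) ^ 3 - ((m - p.1 : ℤ) : ℂ)) =
      ((m : ℂ) ^ 3 - m) * (binom (m - 2) p.1 * binom (n + 1) p.2) := by
    intro p _
    have a := binom_pred (m + 1) p.1
    have b := binom_pred m p.1
    have d := binom_pred (m - 1) p.1
    rw [show m + 1 - 1 = m by ring] at a
    rw [show m - 1 - 1 = m - 2 by ring] at d
    push_cast at a b d ⊢
    linear_combination (binom (n + 1) p.2) * ((m - p.1) * (m - 1 - p.1) * a +
      (m + 1) * (m - 1 - p.1) * b + (m + 1) * m * d)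
  rw [Finset.sum_congr rfl e, ← Finset.mul_sum, h1]
  split_ifs with h
  · subst h; simp [binom_zero]
  · obtain ⟨s, rfl⟩ := Nat.exists_eq_succ_of_ne_zero h
    have : binom (((s + 1 : ℕ) : ℤ) - 1) (s + 1) = 0 := by
      unfold binom
      rw [show ((s + 1 : ℕ) : ℤ) - 1 = (s : ℤ) by push_cast; ring, Ring.choose_natCast]
      simp
    rw [Nat.succ_eq_add_one, this, mul_zero]

theorem binom_sumB (m n : ℤ) (r : ℕ) :
    ∑ p ∈ Finset.HasAntidiagonal.antidiagonal (r + 1), binom (m + 1) p.1 * binom (n + 1) p.2 *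
      ((p.2 : ℂ) - p.1) = ((n : ℂ) - m) * binom (m + n + 1) r := by
  have h1 := binom_vandermonde m (n + 1) r
  have h2 := binom_vandermonde (m + 1) n r
  rw [show m + (n + 1) = m + n + 1 by ring] at h1
  rw [show m + 1 + n = m + n + 1 by ring] at h2
  have e : ∀ p ∈ Finset.HasAntidiagonal.antidiagonal (r + 1), binom (m + 1) p.1 * binom (n + 1) p.2 *
      ((p.2 : ℂ) - p.1) = binom (m + 1) p.1 * (p.2 * binom (n + 1) p.2) -
        (p.1 * binom (m + 1) p.1) * binom (n + 1) p.2 := by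
    intro p _; ring
  rw [Finset.sum_congr rfl e, Finset.sum_sub_distrib, Finset.Nat.antidiagonal_succ',
    Finset.sum_cons, ← Finset.Nat.antidiagonal_succ', Finset.Nat.antidiagonal_succ,
    Finset.sum_cons, Finset.sum_map, Finset.sum_map]
  simp only [Function.Embedding.prodMap, Function.Embedding.coeFn_mk, Prod.map,
    Function.Embedding.refl_apply, Nat.succ_eq_add_one, binom_absorb, add_sub_cancel_right]
  push_cast
  have e1 : ∀ p ∈ Finset.HasAntidiagonal.antidiagonal r, binom (m + 1) p.1 * (((n : ℂ) + 1) * binom n p.2) =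
    ((n : ℂ) + 1) * (binom (m + 1) p.1 * binom n p.2) := by intros; ring
  have e2 : ∀ p ∈ Finset.HasAntidiagonal.antidiagonal r, ((m : ℂ) + 1) * binom m p.1 * binom (n + 1) p.2 =
    ((m : ℂ) + 1) * (binom m p.1 * binom (n + 1) p.2) := by intros; ring
  rw [Finset.sum_congr rfl e1, Finset.sum_congr rfl e2, ← Finset.mul_sum, ← Finset.mul_sum, h1, h2]
  ring

/-- Resummation of a double sum along antidiagonals. -/
theorem sum_box_eq_sum_antidiagonal {M : Type*} [AddCommMonoid M] (F : ℕ → ℕ → M) (N : ℕ)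
    (hF : ∀ i j, N ≤ i + j → F i j = 0) :
    ∑ i ∈ Finset.range N, ∑ j ∈ Finset.range N, F i j =
      ∑ r ∈ Finset.range N, ∑ p ∈ Finset.HasAntidiagonal.antidiagonal r, F p.1 p.2 := by
  rw [Finset.sum_sigma', Finset.sum_sigma']
  symm
  refine Finset.sum_of_injOn (fun x => ⟨x.2.1, x.2.2⟩) ?_ ?_ ?_ ?_
  · rintro ⟨r, a, b⟩ hx ⟨r', a', b'⟩ hx' h
    simp only [Finset.coe_sigma, Set.mem_sigma_iff, Finset.mem_coe, Finset.HasAntidiagonal.mem_antidiagonal,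
      Finset.mem_range, Sigma.mk.injEq] at hx hx' h
    obtain ⟨rfl, h⟩ := h
    obtain rfl := eq_of_heq h
    obtain rfl : r = r' := by omega
    rfl
  · rintro ⟨r, a, b⟩ hx
    simp only [Finset.coe_sigma, Set.mem_sigma_iff, Finset.mem_coe, Finset.HasAntidiagonal.mem_antidiagonal,
      Finset.mem_range] at hx ⊢
    omega
  · rintro ⟨i, j⟩ _ h
    apply hF
    by_contra hlt
    dsimp only at hlt
    apply h
    refine ⟨⟨i + j, i, j⟩, ?_, rfl⟩
    rw [Finset.mem_coe, Finset.mem_sigma, Finset.mem_range, Finset.HasAntidiagonal.mem_antidiagonal]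
    exact ⟨by simpa using hlt, rfl⟩
  · intros; rfl

/-! ### Vertex operators -/

/-- The sum of a sequence of endomorphisms which is locally finite. -/
def locSum {W : Type*} [AddCommGroup W] [Module ℂ W] (f : ℕ → Module.End ℂ W)
    (hf : ∀ w, ∃ N : ℕ, ∀ j, N ≤ j → f j w = 0) : Module.End ℂ W where
  toFun w := ∑ᶠ j, f j w
  map_add' x y := by
    have hs : ∀ w, (Function.support fun j => f j w).Finite := fun w => by
      obtain ⟨N, hN⟩ := hf w
      exact (Set.finite_Iio N).subset fun j hj => by
        by_contra h; exact hj (hN j (by simpa using h))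
    simp only [map_add]
    exact finsum_add_distrib (hs x) (hs y)
  map_smul' a x := by
    simp only [map_smul, RingHom.id_apply]
    exact (smul_finsum a fun j => f j x).symm

theorem finsum_eq_sum_range {M : Type*} [AddCommMonoid M] (f : ℕ → M) (N : ℕ)
    (hf : ∀ j, N ≤ j → f j = 0) : ∑ᶠ j, f j = ∑ j ∈ Finset.range N, f j := by
  refine finsum_eq_sum_of_support_subset f fun j hj => ?_
  by_contra h
  exact hj (hf j (by simpa using h))

theorem locSum_apply {W : Type*} [AddCommGroup W] [Module ℂ W] (f : ℕ → Module.End ℂ W)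
    (hf : ∀ w, ∃ N : ℕ, ∀ j, N ≤ j → f j w = 0) (w : W) (N : ℕ)
    (hN : ∀ j, N ≤ j → f j w = 0) : locSum f hf w = ∑ j ∈ Finset.range N, f j w :=
  finsum_eq_sum_range _ N hN

section Fields

variable {W : Type*} [AddCommGroup W] [Module ℂ W]

/-- The mode `b_k` of a vertex operator `b(x) = ∑ₖ b_k x^{-k-1}`. -/
abbrev mode (b : VertexOperator ℂ W) (k : ℤ) : Module.End ℂ W := VertexOperator.ncoeff b k

theorem mode_trunc (b : VertexOperator ℂ W) (w : W) : ∃ N : ℤ, ∀ k, N ≤ k → mode b k w = 0 := by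
  refine ⟨-HahnSeries.order ((HahnModule.of ℂ).symm (b w)), fun k hk => ?_⟩
  exact VertexOperator.ncoeff_eq_zero_of_lt_order b k w (by omega)

theorem mode_ext {a b : VertexOperator ℂ W} (h : ∀ k w, mode a k w = mode b k w) : a = b := by
  ext w n
  have := h (-n - 1) w
  simp only [mode, ← VertexOperator.coeff_eq_ncoeff] at this
  exact this

/-- The vertex operator with prescribed modes. -/
def ofModes (f : ℤ → Module.End ℂ W) (hf : ∀ w, ∃ N : ℤ, ∀ k, N ≤ k → f k w = 0) :
    VertexOperator ℂ W :=
  VertexOperator.of_coeff (fun n => f (-n - 1)) fun w => by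
    obtain ⟨N, hN⟩ := hf w
    refine ⟨-N, fun n hn => ?_⟩
    by_contra h
    exact hn (hN _ (by omega))

theorem mode_ofModes (f : ℤ → Module.End ℂ W) (hf : ∀ w, ∃ N : ℤ, ∀ k, N ≤ k → f k w = 0)
    (k : ℤ) : mode (ofModes f hf) k = f k := by
  simp only [mode, ofModes, VertexOperator.ncoeff_of_coeff]
  congr 1; ring

/-- The identity field `1_W`. -/
def idField (W : Type*) [AddCommGroup W] [Module ℂ W] : VertexOperator ℂ W :=
  ofModes (fun k => if k = -1 then 1 else 0) fun w => ⟨0, fun k hk => by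
    rw [if_neg (by omega)]; rfl⟩

theorem trunc_nat (b : VertexOperator ℂ W) (k : ℤ) (w : W) :
    ∃ N : ℕ, ∀ j : ℕ, N ≤ j → mode b (k + j) w = 0 := by
  obtain ⟨N, hN⟩ := mode_trunc b w
  exact ⟨(N - k).toNat, fun j hj => hN _ (by omega)⟩

theorem mode_add (a b : VertexOperator ℂ W) (k : ℤ) (w : W) :
    mode (a + b) k w = mode a k w + mode b k w := by simp [mode]

theorem mode_sub (a b : VertexOperator ℂ W) (k : ℤ) (w : W) :
    mode (a - b) k w = mode a k w - mode b k w := by simp [mode]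

theorem mode_smul (r : ℂ) (b : VertexOperator ℂ W) (k : ℤ) (w : W) :
    mode (r • b) k w = r • mode b k w := by simp [mode]

theorem idField_mode (k : ℤ) (w : W) :
    mode (idField W) k w = if k = -1 then w else 0 := by
  rw [idField, mode_ofModes]; split_ifs <;> rfl

variable [Module UVir W] [IsScalarTower ℂ UVir W]

/-- The first half `∑_{j≥0} (-1)^j binom(n+1,j) x^j L_{n-j} b(x)` of the action of `Lₙ` on
fields, namely `(y - x)^{n+1} T(y) b(x)`, expanded in `|y| > |x|`, integrated over `y`. -/
def leftPart (n : ℤ) (b : VertexOperator ℂ W) : VertexOperator ℂ W :=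
  ofModes (fun k => locSum
      (fun j => ((-1 : ℂ) ^ j * binom (n + 1) j) • (Lop W (n - j) * mode b (k + j)))
      fun w => by
        obtain ⟨N, hN⟩ := trunc_nat b k w
        exact ⟨N, fun j hj => by simp [hN j hj]⟩) fun w => by
    obtain ⟨N, hN⟩ := mode_trunc b w
    refine ⟨N, fun k hk => ?_⟩
    rw [locSum_apply _ _ _ 0 fun j _ => by simp [hN (k + j) (by omega)]]
    simp

theorem leftPart_mode (n : ℤ) (b : VertexOperator ℂ W) (k : ℤ) (w : W) (N : ℕ)
    (hN : ∀ j : ℕ, N ≤ j → mode b (k + j) w = 0) :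
    mode (leftPart n b) k w = ∑ j ∈ Finset.range N,
      ((-1 : ℂ) ^ j * binom (n + 1) j) • Lop W (n - j) (mode b (k + j) w) := by
  rw [leftPart, mode_ofModes, locSum_apply _ _ _ N fun j hj => by simp [hN j hj]]
  simp

theorem smooth_nat (c : ℂ) [IsSmoothVir c W] (w : W) :
    ∃ N : ℕ, ∀ j : ℕ, N ≤ j → Lop W ((j : ℤ) - 1) w = 0 := by
  obtain ⟨N, hN⟩ := IsSmoothVir.smooth (c := c) w
  exact ⟨N + 1, fun j hj => hN _ (by omega)⟩

variable (c : ℂ) [IsSmoothVir c W]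

/-- The second half `∑_{j≥0} (-1)^{n+1+j} binom(n+1,j) x^{n+1-j} b(x) L_{j-1}` of the action of
`Lₙ` on fields, namely `(y - x)^{n+1} b(x) T(y)`, expanded in `|x| > |y|`, integrated over `y`. -/
def rightPart (n : ℤ) (b : VertexOperator ℂ W) : VertexOperator ℂ W :=
  ofModes (fun k => locSum
      (fun j => ((-1 : ℂ) ^ (n + 1 + j) * binom (n + 1) j) •
        (mode b (n + 1 + k - j) * Lop W ((j : ℤ) - 1)))
      fun w => by
        obtain ⟨N, hN⟩ := smooth_nat c w
        exact ⟨N, fun j hj => by simp [hN j hj]⟩) fun w => by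
    obtain ⟨N, hN⟩ := smooth_nat c w
    choose M hM using fun j : ℕ => mode_trunc b (Lop W ((j : ℤ) - 1) w)
    obtain ⟨B, hB⟩ := ((Finset.range N).image fun j : ℕ => M j + j - n - 1).exists_le
    refine ⟨B, fun k hk => ?_⟩
    rw [locSum_apply _ _ _ N fun j hj => by simp [hN j hj]]
    refine Finset.sum_eq_zero fun j hj => ?_
    have := hB _ (Finset.mem_image_of_mem _ hj)
    simp [hM j (n + 1 + k - j) (by omega)]

theorem rightPart_mode (n : ℤ) (b : VertexOperator ℂ W) (k : ℤ) (w : W) (N : ℕ)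
    (hN : ∀ j : ℕ, N ≤ j → Lop W ((j : ℤ) - 1) w = 0) :
    mode (rightPart c n b) k w = ∑ j ∈ Finset.range N,
      ((-1 : ℂ) ^ (n + 1 + j) * binom (n + 1) j) •
        mode b (n + 1 + k - j) (Lop W ((j : ℤ) - 1) w) := by
  rw [rightPart, mode_ofModes, locSum_apply _ _ _ N fun j hj => by simp [hN j hj]]
  simp

/-- The linear operator `b ↦ leftPart n b`. -/
def leftOp (W : Type*) [AddCommGroup W] [Module ℂ W] [Module UVir W] [IsScalarTower ℂ UVir W]
    (n : ℤ) : Module.End ℂ (VertexOperator ℂ W) where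
  toFun := leftPart n
  map_add' a b := by
    refine mode_ext fun k w => ?_
    obtain ⟨N, hN⟩ := trunc_nat a k w
    obtain ⟨M, hM⟩ := trunc_nat b k w
    have h1 : ∀ j : ℕ, max N M ≤ j → mode a (k + j) w = 0 := fun j hj => hN j (by omega)
    have h2 : ∀ j : ℕ, max N M ≤ j → mode b (k + j) w = 0 := fun j hj => hM j (by omega)
    rw [mode_add, leftPart_mode n a k w _ h1, leftPart_mode n b k w _ h2,
      leftPart_mode n (a + b) k w _ fun j hj => by rw [mode_add, h1 j hj, h2 j hj, add_zero],
      ← Finset.sum_add_distrib]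
    refine Finset.sum_congr rfl fun j _ => ?_
    rw [mode_add, map_add, smul_add]
  map_smul' r b := by
    refine mode_ext fun k w => ?_
    obtain ⟨N, hN⟩ := trunc_nat b k w
    rw [RingHom.id_apply, mode_smul, leftPart_mode n b k w N hN,
      leftPart_mode n (r • b) k w N fun j hj => by rw [mode_smul, hN j hj, smul_zero],
      Finset.smul_sum]
    refine Finset.sum_congr rfl fun j _ => ?_
    rw [mode_smul, map_smul, smul_comm]

/-- The linear operator `b ↦ rightPart n b`. -/
def rightOp (W : Type*) [AddCommGroup W] [Module ℂ W] [Module UVir W] [IsScalarTower ℂ UVir W]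
    [IsSmoothVir c W] (n : ℤ) : Module.End ℂ (VertexOperator ℂ W) where
  toFun := rightPart c n
  map_add' a b := by
    refine mode_ext fun k w => ?_
    obtain ⟨N, hN⟩ := smooth_nat c w
    rw [mode_add, rightPart_mode c n a k w _ hN, rightPart_mode c n b k w _ hN,
      rightPart_mode c n (a + b) k w _ hN, ← Finset.sum_add_distrib]
    refine Finset.sum_congr rfl fun j _ => ?_
    rw [mode_add, smul_add]
  map_smul' r b := by
    refine mode_ext fun k w => ?_
    obtain ⟨N, hN⟩ := smooth_nat c w
    rw [RingHom.id_apply, mode_smul, rightPart_mode c n b k w N hN,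
      rightPart_mode c n (r • b) k w N hN, Finset.smul_sum]
    refine Finset.sum_congr rfl fun j _ => ?_
    rw [mode_smul, smul_comm]

theorem leftOp_comm (m n : ℤ) (b : VertexOperator ℂ W) :
    leftOp W m (leftOp W n b) - leftOp W n (leftOp W m b) =
      ((m : ℂ) - n) • leftOp W (m + n) b +
      (if m + n = 0 then ((m : ℂ) ^ 3 - m) / 12 * c else 0) • b := by
  refine mode_ext fun k w => ?_
  obtain ⟨N', hN'⟩ := trunc_nat b k w
  set N := N' + 1 with hNdef
  have hN : ∀ j : ℕ, N ≤ j → mode b (k + j) w = 0 := fun j hj => hN' j (by omega)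
  have hN2 : ∀ i j : ℕ, N ≤ i + j → mode b (k + i + j) w = 0 := fun i j hj => by
    rw [add_assoc, ← Nat.cast_add]; exact hN _ hj
  have dbl : ∀ m n : ℤ, mode (leftOp W m (leftOp W n b)) k w =
      ∑ i ∈ Finset.range N, ∑ j ∈ Finset.range N,
        (((-1 : ℂ) ^ i * binom (m + 1) i) * ((-1 : ℂ) ^ j * binom (n + 1) j)) •
          Lop W (m - i) (Lop W (n - j) (mode b (k + i + j) w)) := by
    intro m n
    have h1 : ∀ i : ℕ, mode (leftPart n b) (k + i) w = ∑ j ∈ Finset.range N,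
      ((-1 : ℂ) ^ j * binom (n + 1) j) • Lop W (n - j) (mode b (k + i + j) w) := fun i =>
      leftPart_mode n b (k + i) w N fun j hj => hN2 i j (by omega)
    change mode (leftPart m (leftPart n b)) k w = _
    rw [leftPart_mode m (leftPart n b) k w N fun i hi => by
      rw [h1]
      exact Finset.sum_eq_zero fun j _ => by rw [hN2 i j (by omega), map_zero, smul_zero]]
    refine Finset.sum_congr rfl fun i _ => ?_
    rw [h1, map_sum, Finset.smul_sum]
    refine Finset.sum_congr rfl fun j _ => ?_
    rw [map_smul, smul_smul]
  rw [mode_sub, mode_add, mode_smul, mode_smul, dbl, dbl n m, Finset.sum_comm (f := fun i j =>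
    (((-1 : ℂ) ^ i * binom (n + 1) i) * ((-1 : ℂ) ^ j * binom (m + 1) j)) •
          Lop W (n - i) (Lop W (m - j) (mode b (k + i + j) w))), ← Finset.sum_sub_distrib]
  simp only [← Finset.sum_sub_distrib]
  have term : ∀ i j : ℕ,
      (((-1 : ℂ) ^ i * binom (m + 1) i) * ((-1 : ℂ) ^ j * binom (n + 1) j)) •
          Lop W (m - i) (Lop W (n - j) (mode b (k + i + j) w)) -
      (((-1 : ℂ) ^ j * binom (n + 1) j) * ((-1 : ℂ) ^ i * binom (m + 1) i)) •
          Lop W (n - j) (Lop W (m - i) (mode b (k + j + i) w)) =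
      ((-1 : ℂ) ^ (i + j) * (binom (m + 1) i * binom (n + 1) j)) •
        ((((m - i : ℤ) : ℂ) - ((n - j : ℤ) : ℂ)) • Lop W (m + n - (i + j : ℕ))
            (mode b (k + (i + j : ℕ)) w) +
          (if m + n = (i + j : ℕ) then (((m - i : ℤ) : ℂ) ^ 3 - ((m - i : ℤ) : ℂ)) / 12 * c
            else 0) • mode b (k + (i + j : ℕ)) w) := by
    intro i j
    have h := Lop_comm c (m - i) (n - j) (mode b (k + (i + j : ℕ)) w)
    rw [show m - (i : ℤ) + (n - j) = m + n - (i + j : ℕ) by push_cast; ring] at h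
    simp only [sub_eq_zero (a := m + n)] at h
    rw [show k + (j : ℤ) + i = k + (i + j : ℕ) by push_cast; ring,
      show k + (i : ℤ) + j = k + (i + j : ℕ) by push_cast; ring, ← h, smul_sub]
    congr 2 <;> ring
  simp only [term]
  rw [sum_box_eq_sum_antidiagonal _ N fun i j hij => by rw [hN _ hij]; simp]
  have inner : ∀ r : ℕ, ∑ p ∈ Finset.HasAntidiagonal.antidiagonal r,
      ((-1 : ℂ) ^ (p.1 + p.2) * (binom (m + 1) p.1 * binom (n + 1) p.2)) •
        ((((m - p.1 : ℤ) : ℂ) - ((n - p.2 : ℤ) : ℂ)) • Lop W (m + n - (p.1 + p.2 : ℕ))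
            (mode b (k + (p.1 + p.2 : ℕ)) w) +
          (if m + n = (p.1 + p.2 : ℕ) then
            (((m - p.1 : ℤ) : ℂ) ^ 3 - ((m - p.1 : ℤ) : ℂ)) / 12 * c
            else 0) • mode b (k + (p.1 + p.2 : ℕ)) w) =
      ((m : ℂ) - n) • (((-1 : ℂ) ^ r * binom (m + n + 1) r) •
        Lop W (m + n - r) (mode b (k + r) w)) +
      (if r = 0 then (if m + n = 0 then ((m : ℂ) ^ 3 - m) / 12 * c else 0) else 0) •
        mode b (k + r) w := by
    intro r
    have e : ∀ p ∈ Finset.HasAntidiagonal.antidiagonal r,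
      ((-1 : ℂ) ^ (p.1 + p.2) * (binom (m + 1) p.1 * binom (n + 1) p.2)) •
        ((((m - p.1 : ℤ) : ℂ) - ((n - p.2 : ℤ) : ℂ)) • Lop W (m + n - (p.1 + p.2 : ℕ))
            (mode b (k + (p.1 + p.2 : ℕ)) w) +
          (if m + n = (p.1 + p.2 : ℕ) then
            (((m - p.1 : ℤ) : ℂ) ^ 3 - ((m - p.1 : ℤ) : ℂ)) / 12 * c
            else 0) • mode b (k + (p.1 + p.2 : ℕ)) w) =
      ((-1 : ℂ) ^ r * (binom (m + 1) p.1 * binom (n + 1) p.2 *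
        (((m - p.1 : ℤ) : ℂ) - ((n - p.2 : ℤ) : ℂ)))) • Lop W (m + n - r) (mode b (k + r) w) +
      ((-1 : ℂ) ^ r * (if m + n = r then c / 12 else 0) * (binom (m + 1) p.1 * binom (n + 1) p.2 *
        (((m - p.1 : ℤ) : ℂ) ^ 3 - ((m - p.1 : ℤ) : ℂ)))) • mode b (k + r) w := by
      intro p hp
      rw [Finset.HasAntidiagonal.mem_antidiagonal.1 hp, smul_add, smul_smul, smul_smul]
      congr 2
      · ring
      · split_ifs <;> ring
    rw [Finset.sum_congr rfl e, Finset.sum_add_distrib, ← Finset.sum_smul, ← Finset.sum_smul,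
      ← Finset.mul_sum, ← Finset.mul_sum, binom_sumA, smul_smul]
    congr 2
    · ring
    · by_cases h : m + n = r
      · rw [binom_sumC m n r h.symm]
        by_cases hr : r = 0
        · subst hr; simp only [if_true, pow_zero, h]; simp; ring
        · simp [hr]
      · by_cases hr : r = 0
        · subst hr; simp at h; simp [h]
        · simp [h, hr]
  rw [Finset.sum_congr rfl fun r _ => inner r, Finset.sum_add_distrib, ← Finset.smul_sum]
  congr 1
  · change _ = _ • mode (leftPart (m + n) b) k w
    rw [leftPart_mode (m + n) b k w N hN]
  · rw [hNdef, Finset.sum_range_succ']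
    simp


theorem rightOp_comm (m n : ℤ) (b : VertexOperator ℂ W) :
    rightOp c W m (rightOp c W n b) - rightOp c W n (rightOp c W m b) =
      ((n : ℂ) - m) • rightOp c W (m + n) b := by
  refine mode_ext fun k w => ?_
  obtain ⟨N₀, hN₀⟩ := smooth_nat c w
  choose M hM using fun i : ℕ => smooth_nat c (Lop W ((i : ℤ) - 1) w)
  obtain ⟨B, hB⟩ := ((Finset.range N₀).image M).exists_le
  set N := max N₀ B
  have h0 : ∀ j : ℕ, N ≤ j → Lop W ((j : ℤ) - 1) w = 0 := fun j hj => hN₀ j (by omega)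
  have h1 : ∀ i j : ℕ, N ≤ j → Lop W ((j : ℤ) - 1) (Lop W ((i : ℤ) - 1) w) = 0 := by
    intro i j hj
    by_cases hi : i < N₀
    · have := hB _ (Finset.mem_image_of_mem M (Finset.mem_range.2 hi))
      exact hM i j (by omega)
    · rw [hN₀ i (by omega), map_zero]
  have dbl : ∀ m n : ℤ, mode (rightOp c W m (rightOp c W n b)) k w =
      ∑ i ∈ Finset.range (2 * N + 1), ∑ j ∈ Finset.range (2 * N + 1),
        (((-1 : ℂ) ^ (m + 1 + i) * binom (m + 1) i) *
          ((-1 : ℂ) ^ (n + 1 + j) * binom (n + 1) j)) •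
          mode b (m + n + 2 + k - (i + j : ℕ))
            (Lop W ((j : ℤ) - 1) (Lop W ((i : ℤ) - 1) w)) := by
    intro m n
    change mode (rightPart c m (rightPart c n b)) k w = _
    rw [rightPart_mode c m (rightPart c n b) k w (2 * N + 1) fun j hj => h0 j (by omega)]
    refine Finset.sum_congr rfl fun i _ => ?_
    rw [rightPart_mode c n b _ _ (2 * N + 1) fun j hj => h1 i j (by omega), Finset.smul_sum]
    refine Finset.sum_congr rfl fun j _ => ?_
    rw [smul_smul, show n + 1 + (m + 1 + k - (i : ℤ)) - j = m + n + 2 + k - (i + j : ℕ) by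
      push_cast; ring]
  rw [mode_sub, mode_smul, dbl, dbl n m, Finset.sum_comm (f := fun i j : ℕ =>
    (((-1 : ℂ) ^ (n + 1 + i) * binom (n + 1) i) *
          ((-1 : ℂ) ^ (m + 1 + j) * binom (m + 1) j)) •
          mode b (n + m + 2 + k - (i + j : ℕ))
            (Lop W ((j : ℤ) - 1) (Lop W ((i : ℤ) - 1) w))), ← Finset.sum_sub_distrib]
  simp only [← Finset.sum_sub_distrib]
  have hsign : ∀ i j : ℕ, (-1 : ℂ) ^ (m + 1 + i) * (-1 : ℂ) ^ (n + 1 + j) =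
      (-1 : ℂ) ^ (m + n + (i + j : ℕ)) := by
    intro i j
    rw [← zpow_add₀ (by norm_num), show m + 1 + (i : ℤ) + (n + 1 + j) =
      (m + n + (i + j : ℕ)) + 2 by push_cast; ring, zpow_add₀ (by norm_num)]
    norm_num
  have term : ∀ i j : ℕ,
      (((-1 : ℂ) ^ (m + 1 + i) * binom (m + 1) i) *
          ((-1 : ℂ) ^ (n + 1 + j) * binom (n + 1) j)) •
          mode b (m + n + 2 + k - (i + j : ℕ))
            (Lop W ((j : ℤ) - 1) (Lop W ((i : ℤ) - 1) w)) -
      (((-1 : ℂ) ^ (n + 1 + j) * binom (n + 1) j) *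
          ((-1 : ℂ) ^ (m + 1 + i) * binom (m + 1) i)) •
          mode b (n + m + 2 + k - (j + i : ℕ))
            (Lop W ((i : ℤ) - 1) (Lop W ((j : ℤ) - 1) w)) =
      ((-1 : ℂ) ^ (m + n + (i + j : ℕ)) * (binom (m + 1) i * binom (n + 1) j *
        ((j : ℂ) - i))) • mode b (m + n + 2 + k - (i + j : ℕ))
          (Lop W ((i + j : ℕ) - 2) w) := by
    intro i j
    have h := Lop_comm c ((j : ℤ) - 1) ((i : ℤ) - 1) w
    have hz : (if (j : ℤ) - 1 + ((i : ℤ) - 1) = 0 then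
        ((((j : ℤ) - 1 : ℤ) : ℂ) ^ 3 - (((j : ℤ) - 1 : ℤ) : ℂ)) / 12 * c else 0) = 0 := by
      split_ifs with hij
      · have : j = 0 ∨ j = 1 ∨ j = 2 := by omega
        rcases this with rfl | rfl | rfl <;> norm_num
      · rfl
    rw [hz, zero_smul, add_zero, show (j : ℤ) - 1 + ((i : ℤ) - 1) = (i + j : ℕ) - 2 by
      push_cast; ring] at h
    rw [add_comm n m, add_comm j i, mul_comm ((-1 : ℂ) ^ (n + 1 + j) * binom (n + 1) j),
      ← smul_sub, ← map_sub, h, map_smul, smul_smul, ← hsign]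
    congr 1
    push_cast
    ring
  simp only [term]
  rw [sum_box_eq_sum_antidiagonal _ _ fun i j hij => by
    rw [show ((i + j : ℕ) : ℤ) - 2 = ((i + j - 1 : ℕ) : ℤ) - 1 by omega, h0 _ (by omega),
      map_zero, smul_zero]]
  have inner : ∀ r : ℕ, ∑ p ∈ Finset.HasAntidiagonal.antidiagonal r,
      ((-1 : ℂ) ^ (m + n + (p.1 + p.2 : ℕ)) * (binom (m + 1) p.1 * binom (n + 1) p.2 *
        ((p.2 : ℂ) - p.1))) • mode b (m + n + 2 + k - (p.1 + p.2 : ℕ))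
          (Lop W ((p.1 + p.2 : ℕ) - 2) w) =
      ((-1 : ℂ) ^ (m + n + r) * ∑ p ∈ Finset.HasAntidiagonal.antidiagonal r,
        binom (m + 1) p.1 * binom (n + 1) p.2 * ((p.2 : ℂ) - p.1)) •
        mode b (m + n + 2 + k - r) (Lop W ((r : ℤ) - 2) w) := by
    intro r
    rw [Finset.mul_sum, Finset.sum_smul]
    refine Finset.sum_congr rfl fun p hp => ?_
    rw [Finset.HasAntidiagonal.mem_antidiagonal.1 hp]
  rw [Finset.sum_congr rfl fun r _ => inner r, Finset.sum_range_succ']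
  simp only [binom_sumB]
  change _ = _ • mode (rightPart c (m + n) b) k w
  rw [rightPart_mode c (m + n) b k w (2 * N) fun j hj => h0 j (by omega), Finset.smul_sum]
  simp only [Finset.HasAntidiagonal.antidiagonal_zero, Finset.sum_singleton, sub_self, mul_zero,
    zero_smul, add_zero]
  refine Finset.sum_congr rfl fun s _ => ?_
  rw [smul_smul, show m + n + 2 + k - ((s + 1 : ℕ) : ℤ) = m + n + 1 + k - s by push_cast; ring,
    show ((s + 1 : ℕ) : ℤ) - 2 = (s : ℤ) - 1 by push_cast; ring,
    show m + n + ((s + 1 : ℕ) : ℤ) = m + n + 1 + s by push_cast; ring]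
  congr 1
  ring

theorem leftOp_rightOp_comm (m n : ℤ) (b : VertexOperator ℂ W) :
    leftOp W m (rightOp c W n b) = rightOp c W n (leftOp W m b) := by
  refine mode_ext fun k w => ?_
  obtain ⟨N, hN⟩ := smooth_nat c w
  choose M hM using fun j : ℕ => trunc_nat b (n + 1 + k - j) (Lop W ((j : ℤ) - 1) w)
  obtain ⟨B, hB⟩ := ((Finset.range N).image M).exists_le
  have hb : ∀ j : ℕ, j < N → ∀ i : ℕ, B ≤ i →
      mode b (n + 1 + k - j + i) (Lop W ((j : ℤ) - 1) w) = 0 := fun j hj i hi => by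
    have := hB _ (Finset.mem_image_of_mem M (Finset.mem_range.2 hj))
    exact hM j i (by omega)
  have h1 : ∀ i : ℕ, mode (rightPart c n b) (k + i) w = ∑ j ∈ Finset.range N,
      ((-1 : ℂ) ^ (n + 1 + j) * binom (n + 1) j) •
        mode b (n + 1 + k - j + i) (Lop W ((j : ℤ) - 1) w) := by
    intro i
    rw [rightPart_mode c n b (k + i) w N hN]
    refine Finset.sum_congr rfl fun j _ => ?_
    rw [show n + 1 + (k + i) - (j : ℤ) = n + 1 + k - j + i by ring]
  change mode (leftPart m (rightPart c n b)) k w = mode (rightPart c n (leftPart m b)) k w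
  rw [leftPart_mode m (rightPart c n b) k w B fun i hi => by
      rw [h1]
      exact Finset.sum_eq_zero fun j hj => by
        rw [hb j (Finset.mem_range.1 hj) i hi, smul_zero],
    rightPart_mode c n (leftPart m b) k w N hN]
  have e : ∀ j ∈ Finset.range N, ((-1 : ℂ) ^ (n + 1 + j) * binom (n + 1) j) •
        mode (leftPart m b) (n + 1 + k - j) (Lop W ((j : ℤ) - 1) w) =
      ∑ i ∈ Finset.range B, ((-1 : ℂ) ^ (n + 1 + j) * binom (n + 1) j) •
        (((-1 : ℂ) ^ i * binom (m + 1) i) •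
          Lop W (m - i) (mode b (n + 1 + k - j + i) (Lop W ((j : ℤ) - 1) w))) := by
    intro j hj
    rw [leftPart_mode m b _ _ B (hb j (Finset.mem_range.1 hj)), Finset.smul_sum]
  rw [Finset.sum_congr rfl e, Finset.sum_comm]
  refine Finset.sum_congr rfl fun i _ => ?_
  rw [h1, map_sum, Finset.smul_sum]
  refine Finset.sum_congr rfl fun j _ => ?_
  rw [map_smul, smul_comm]

/-- The action of `Lₙ` on the vertex operators on `W`:
`(Lₙ b)(x) = Res_y ((y - x)^{n+1} T(y) b(x) - (-x + y)^{n+1} b(x) T(y))`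
with `T(y) = ∑ₙ Lₙ y^{-n-2}`. This is the normally ordered product
`1/(-n-2)! : (d/dx)^{-n-2} T(x) b(x) :` if `n ≤ -2`. -/
def fieldOp (W : Type*) [AddCommGroup W] [Module ℂ W] [Module UVir W] [IsScalarTower ℂ UVir W]
    [IsSmoothVir c W] (n : ℤ) : Module.End ℂ (VertexOperator ℂ W) :=
  leftOp W n - rightOp c W n

theorem fieldOp_comm (m n : ℤ) (b : VertexOperator ℂ W) :
    fieldOp c W m (fieldOp c W n b) - fieldOp c W n (fieldOp c W m b) =
      ((m : ℂ) - n) • fieldOp c W (m + n) b +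
      (if m + n = 0 then ((m : ℂ) ^ 3 - m) / 12 else 0) • c • b := by
  have h1 := leftOp_comm c m n b
  have h2 := rightOp_comm c m n b
  have h3 := leftOp_rightOp_comm c m n b
  have h4 := leftOp_rightOp_comm c n m b
  simp only [fieldOp, LinearMap.sub_apply, map_sub, smul_sub, smul_smul]
  rw [h3, h4]
  have h5 : ((n : ℂ) - m) • rightOp c W (m + n) b = -(((m : ℂ) - n) • rightOp c W (m + n) b) := by
    rw [show (n : ℂ) - m = -((m : ℂ) - n) by ring]; exact neg_smul ((m : ℂ) - n) (rightOp c W (m + n) b)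
  rw [h5] at h2
  have h6 : (if m + n = 0 then ((m : ℂ) ^ 3 - m) / 12 else 0) * c =
    (if m + n = 0 then ((m : ℂ) ^ 3 - m) / 12 * c else 0) := by split_ifs <;> simp
  rw [h6]
  have h7 := congrArg₂ (fun u v => u + v) h1 h2
  convert h7 using 1 <;> abel

theorem fieldOp_bracketAux (a d : ℤ →₀ ℂ) (b : VertexOperator ℂ W) :
    Finsupp.linearCombination ℂ (fieldOp c W) a (Finsupp.linearCombination ℂ (fieldOp c W) d b) -
      Finsupp.linearCombination ℂ (fieldOp c W) d (Finsupp.linearCombination ℂ (fieldOp c W) a b) =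
    Finsupp.linearCombination ℂ (fieldOp c W) (Vir.bracketAux a d).1 b +
      (Vir.bracketAux a d).2 • c • b := by
  have fst_add : ∀ x y : Vir, (x + y).1 = x.1 + y.1 := fun _ _ => rfl
  have snd_add : ∀ x y : Vir, (x + y).2 = x.2 + y.2 := fun _ _ => rfl
  have fst_smul : ∀ (r : ℂ) (y : Vir), (r • y).1 = r • y.1 := fun _ _ => rfl
  have snd_smul : ∀ (r : ℂ) (y : Vir), (r • y).2 = r • y.2 := fun _ _ => rfl
  have fst_zero : (0 : Vir).1 = 0 := rfl
  have snd_zero : (0 : Vir).2 = 0 := rfl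
  induction a using Finsupp.induction_linear with
  | zero => simp [fst_zero, snd_zero]
  | add f g hf hg =>
    simp only [map_add, LinearMap.add_apply, fst_add, snd_add, add_smul]
    rw [add_add_add_comm, ← hf, ← hg]; abel
  | single m s =>
    induction d using Finsupp.induction_linear with
    | zero => simp [fst_zero, snd_zero]
    | add f g hf hg =>
      simp only [map_add, LinearMap.add_apply, fst_add, snd_add, add_smul]
      rw [add_add_add_comm, ← hf, ← hg]; abel
    | single n t =>
      have hsnd : (Vir.basisBracket m n).2 =
          if m + n = 0 then ((m : ℂ) ^ 3 - m) / 12 else 0 := by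
        have h : (Vir.basisBracket m n).2 = ((m : ℂ) - n) • (Vir.L (m + n)).2 +
          (if m + n = 0 then ((m : ℂ) ^ 3 - m) / 12 else 0) • Vir.C.2 := rfl
        rw [h]; simp [Vir.L, Vir.C]
      rw [Vir.bracketAux_single, fst_smul, snd_smul, Vir.basisBracket_fst, hsnd, map_smul,
        Finsupp.linearCombination_single, Finsupp.linearCombination_single,
        Finsupp.linearCombination_single]
      simp only [LinearMap.smul_apply, map_smul, smul_assoc]
      rw [← smul_add, ← fieldOp_comm, smul_comm t s]
      module

/-- The representation of the Virasoro algebra on the vertex operators on `W`. -/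
def fieldRep (W : Type*) [AddCommGroup W] [Module ℂ W] [Module UVir W] [IsScalarTower ℂ UVir W]
    [IsSmoothVir c W] : Vir →ₗ⁅ℂ⁆ Module.End ℂ (VertexOperator ℂ W) where
  toFun x := Finsupp.linearCombination ℂ (fieldOp c W) x.1 + x.2 • (c • 1)
  map_add' x y := by
    change Finsupp.linearCombination ℂ (fieldOp c W) (x.1 + y.1) + (x.2 + y.2) • (c • 1) = _
    rw [map_add, add_smul]; abel
  map_smul' r x := by
    change Finsupp.linearCombination ℂ (fieldOp c W) (r • x.1) + (r • x.2) • (c • 1) = _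
    rw [map_smul, RingHom.id_apply, smul_add, smul_assoc]
  map_lie' {x y} := by
    refine LinearMap.ext fun b => ?_
    have h := fieldOp_bracketAux c x.1 y.1 b
    change Finsupp.linearCombination ℂ (fieldOp c W) (Vir.bracketAux x.1 y.1).1 b +
      (Vir.bracketAux x.1 y.1).2 • c • b =
      (Finsupp.linearCombination ℂ (fieldOp c W) x.1
          (Finsupp.linearCombination ℂ (fieldOp c W) y.1 b + y.2 • c • b) +
        x.2 • c • (Finsupp.linearCombination ℂ (fieldOp c W) y.1 b + y.2 • c • b)) -
      (Finsupp.linearCombination ℂ (fieldOp c W) y.1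
          (Finsupp.linearCombination ℂ (fieldOp c W) x.1 b + x.2 • c • b) +
        y.2 • c • (Finsupp.linearCombination ℂ (fieldOp c W) x.1 b + x.2 • c • b))
    rw [← h]
    simp only [map_add, map_smul, smul_add, smul_smul]
    rw [show x.2 * (c * (y.2 * c)) = y.2 * (c * (x.2 * c)) by ring]
    abel

end Fields

/-! ### The universal Virasoro vertex operator algebra and its vertex operators -/

/-- The left ideal `U(vir)(C - c) + ∑_{n ≥ -1} U(vir) Lₙ`. -/
def vacuumIdeal (c : ℂ) : Submodule UVir UVir :=
  Submodule.span UVir ({uC - algebraMap ℂ UVir c} ∪ {u | ∃ n : ℤ, -1 ≤ n ∧ u = uL n})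

/-- The space of states of the universal Virasoro VOA `V_c`. -/
abbrev VirVOA (c : ℂ) : Type := UVir ⧸ vacuumIdeal c

/-- The vacuum vector `1`. -/
def vacuum (c : ℂ) : VirVOA c := Submodule.Quotient.mk 1

/-- The conformal vector `ω = [L₋₂]`. -/
def conformalVector (c : ℂ) : VirVOA c := Submodule.Quotient.mk (uL (-2))

section VertexOperators

variable (c : ℂ) (W : Type*) [AddCommGroup W] [Module ℂ W] [Module UVir W]
  [IsScalarTower ℂ UVir W] [IsSmoothVir c W]

/-- The action of `U(vir)` on the vertex operators on `W`. -/
def fieldAct : UVir →ₐ[ℂ] Module.End ℂ (VertexOperator ℂ W) :=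
  UniversalEnvelopingAlgebra.lift ℂ (fieldRep c W)

theorem fieldAct_uL (n : ℤ) : fieldAct c W (uL n) = fieldOp c W n := by
  rw [fieldAct, uL, UniversalEnvelopingAlgebra.lift_ι_apply]
  change Finsupp.linearCombination ℂ (fieldOp c W) (Finsupp.single n 1) + (0 : ℂ) • (c • 1) = _
  simp

theorem fieldAct_uC : fieldAct c W uC = c • 1 := by
  rw [fieldAct, uC, UniversalEnvelopingAlgebra.lift_ι_apply]
  change Finsupp.linearCombination ℂ (fieldOp c W) 0 + (1 : ℂ) • (c • 1) = _
  simp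

variable {W}

theorem fieldOp_idField (n k : ℤ) (w : W) : mode (fieldOp c W n (idField W)) k w =
    ((if k ≤ -1 then (-1 : ℂ) ^ (-1 - k).toNat * binom (n + 1) (-1 - k).toNat else 0) -
      (if 0 ≤ n + 2 + k then (-1 : ℂ) ^ (n + 1 + (n + 2 + k)) *
        binom (n + 1) (n + 2 + k).toNat else 0)) • Lop W (n + 1 + k) w := by
  rw [fieldOp, LinearMap.sub_apply, mode_sub, sub_smul]
  congr 1
  · change mode (leftPart n (idField W)) k w = _
    rw [leftPart_mode n (idField W) k w ((-1 - k).toNat + 1) fun j hj => by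
      rw [idField_mode, if_neg (by omega)]]
    split_ifs with h
    · rw [Finset.sum_eq_single (-1 - k).toNat]
      · rw [idField_mode, if_pos (by omega)]; congr 2; congr 1; omega
      · intro j _ hj
        rw [idField_mode, if_neg (by omega), map_zero, smul_zero]
      · intro h; simp at h
    · rw [zero_smul]
      refine Finset.sum_eq_zero fun j _ => ?_
      rw [idField_mode, if_neg (by omega), map_zero, smul_zero]
  · change mode (rightPart c n (idField W)) k w = _
    obtain ⟨N, hN⟩ := smooth_nat c w
    rw [rightPart_mode c n (idField W) k w (N + (n + 2 + k).toNat + 1) fun j hj =>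
      hN j (by omega)]
    split_ifs with h
    · rw [Finset.sum_eq_single (n + 2 + k).toNat]
      · rw [idField_mode, if_pos (by omega)]
        congr 2
        · congr 1; omega
        · congr 1; omega
      · intro j _ hj
        rw [idField_mode, if_neg (by omega), smul_zero]
      · intro h; simp at h
    · rw [zero_smul]
      refine Finset.sum_eq_zero fun j _ => ?_
      rw [idField_mode, if_neg (by omega), smul_zero]

theorem fieldOp_idField_eq_zero (n : ℤ) (hn : -1 ≤ n) : fieldOp c W n (idField W) = 0 := by
  refine mode_ext fun k w => ?_
  have h0 : mode (0 : VertexOperator ℂ W) k w = 0 := by simp [mode]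
  rw [fieldOp_idField, h0]
  obtain ⟨p, rfl⟩ : ∃ p : ℕ, n = (p : ℤ) - 1 := ⟨(n + 1).toNat, by omega⟩
  have hb : ∀ j, binom ((p : ℤ) - 1 + 1) j = (p.choose j : ℂ) := by
    intro j
    unfold binom
    rw [sub_add_cancel, Ring.choose_natCast]
    simp
  rw [hb, hb]
  suffices h : ((if k ≤ -1 then (-1 : ℂ) ^ (-1 - k).toNat * (p.choose (-1 - k).toNat : ℂ) else 0) -
      (if 0 ≤ (p : ℤ) - 1 + 2 + k then (-1 : ℂ) ^ ((p : ℤ) - 1 + 1 + ((p : ℤ) - 1 + 2 + k)) *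
        (p.choose ((p : ℤ) - 1 + 2 + k).toNat : ℂ) else 0)) = 0 by
    rw [h, zero_smul]
  by_cases h1 : k ≤ -1
  · obtain ⟨a, rfl⟩ : ∃ a : ℕ, k = -1 - (a : ℤ) := ⟨(-1 - k).toNat, by omega⟩
    rw [if_pos h1, show (-1 - (-1 - (a : ℤ))).toNat = a by omega]
    by_cases h2 : a ≤ p
    · rw [if_pos (by omega), show ((p : ℤ) - 1 + 2 + (-1 - (a : ℤ))).toNat = p - a by omega,
        Nat.choose_symm h2, show (p : ℤ) - 1 + 1 + ((p : ℤ) - 1 + 2 + (-1 - (a : ℤ))) =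
          2 * ((p : ℤ) - a) + a by ring, zpow_add₀ (by norm_num), zpow_mul]
      norm_num
    · rw [if_neg (by omega), Nat.choose_eq_zero_of_lt (by omega)]; simp
  · rw [if_neg h1, if_pos (by omega), Nat.choose_eq_zero_of_lt (by omega)]; simp

variable (W)

theorem vacuumIdeal_le : (vacuumIdeal c).restrictScalars ℂ ≤
    LinearMap.ker ((LinearMap.applyₗ (idField W)).comp (fieldAct c W).toLinearMap) := by
  intro u hu
  rw [Submodule.restrictScalars_mem] at hu
  rw [LinearMap.mem_ker]
  change fieldAct c W u (idField W) = 0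
  refine Submodule.span_induction (p := fun u _ => fieldAct c W u (idField W) = 0)
    ?_ ?_ ?_ ?_ hu
  · rintro x (rfl | ⟨n, hn, rfl⟩)
    · rw [map_sub, fieldAct_uC, AlgHom.commutes, Algebra.algebraMap_eq_smul_one, sub_self]; rfl
    · rw [fieldAct_uL, fieldOp_idField_eq_zero c n hn]
  · rw [map_zero]; rfl
  · intro x y _ _ hx hy; rw [map_add, LinearMap.add_apply, hx, hy, add_zero]
  · intro a x _ hx; rw [smul_eq_mul, map_mul, Module.End.mul_apply, hx, map_zero]

/-- The vertex operator map `Y_W(-, x) : V_c → End(W)[[x^{±1}]]` of a smooth Virasoro module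
`W` of central charge `c`. It is the linear map determined by `Y_W(1, x) = id_W` and
`Y_W(Lₙ v, x) = Res_y ((y - x)^{n+1} T(y) Y_W(v, x) - (-x + y)^{n+1} Y_W(v, x) T(y))`
where `T(y) = ∑ₙ Lₙ y^{-n-2} = Y_W(ω, y)`. For `W = V_c` this is the
state-field correspondence. -/
def vertexOp : VirVOA c →ₗ[ℂ] VertexOperator ℂ W :=
  (Submodule.liftQ _ _ (vacuumIdeal_le c W)).comp
    (Submodule.Quotient.restrictScalarsEquiv ℂ (vacuumIdeal c)).symm.toLinearMap

theorem vertexOp_mk (u : UVir) :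
    vertexOp c W (Submodule.Quotient.mk u) = fieldAct c W u (idField W) := rfl

theorem vertexOp_vacuum : vertexOp c W (vacuum c) = idField W := by
  rw [vacuum, vertexOp_mk, map_one]; rfl

theorem vertexOp_uL_smul (n : ℤ) (v : VirVOA c) :
    vertexOp c W (uL n • v) = fieldOp c W n (vertexOp c W v) := by
  obtain ⟨u, rfl⟩ := Submodule.Quotient.mk_surjective _ v
  rw [← Submodule.Quotient.mk_smul, vertexOp_mk, vertexOp_mk, smul_eq_mul, map_mul, fieldAct_uL]
  rfl

variable {W}

/-- `Y_W(ω, x) = ∑ₙ Lₙ x^{-n-2}`. -/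
theorem vertexOp_conformalVector (n : ℤ) (w : W) :
    mode (vertexOp c W (conformalVector c)) (n + 1) w = Lop W n w := by
  rw [conformalVector, vertexOp_mk, fieldAct_uL, fieldOp_idField]
  have hb : ∀ j, binom (-2 + 1) j = (-1) ^ j := by
    intro j
    unfold binom
    rw [show (-2 + 1 : ℤ) = -1 by norm_num, Ring.choose_neg,
      show (1 : ℤ) + j - 1 = (j : ℤ) by ring, Ring.choose_natCast, Nat.choose_self]
    simp [Int.negOnePow_def, Units.smul_def]
  rw [hb, hb, show -2 + 1 + (n + 1) = n by ring]
  conv_rhs => rw [← one_smul ℂ (Lop W n w)]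
  congr 1
  by_cases h : n + 1 ≤ -1
  · rw [if_pos h, if_neg (by omega), ← mul_pow]; norm_num
  · rw [if_neg h, if_pos (by omega)]
    obtain ⟨j, rfl⟩ : ∃ j : ℕ, n = (j : ℤ) - 1 := ⟨(n + 1).toNat, by omega⟩
    rw [show (-2 + 2 + ((j : ℤ) - 1 + 1)).toNat = j by omega,
      show (-2 + 1 + (-2 + 2 + ((j : ℤ) - 1 + 1))) = -1 + (j : ℤ) by ring,
      zpow_add₀ (by norm_num), zpow_natCast, mul_assoc, ← mul_pow]
    norm_num

end VertexOperators

/-! ### Verma modules and the first-row modules -/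

theorem isSmoothVir_of_generator (c h : ℂ) {W : Type*} [AddCommGroup W] [Module ℂ W]
    [Module UVir W] [IsScalarTower ℂ UVir W] (v : W) (hgen : ∀ w : W, ∃ u : UVir, u • v = w)
    (hC : uC • v = c • v) (h0 : uL 0 • v = h • v) (hpos : ∀ n : ℤ, 1 ≤ n → uL n • v = 0) :
    IsSmoothVir c W := by
  have comm : ∀ (m n : ℤ) (w : W), uL m • uL n • w = uL n • uL m • w +
      (((m : ℂ) - n) • uL (m + n) • w +
        (if m + n = 0 then ((m : ℂ) ^ 3 - m) / 12 else 0) • uC • w) := by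
    intro m n w
    have := congrArg (fun u : UVir => u • w) (uL_comm m n)
    rw [sub_smul, add_smul, smul_assoc, smul_assoc, mul_smul, mul_smul] at this
    rw [← this]; abel
  have commC : ∀ (n : ℤ) (w : W), uC • uL n • w = uL n • uC • w := by
    intro n w
    rw [smul_smul, uC_comm, mul_smul]
  have smulC : ∀ (u : UVir) (a : ℂ) (w : W), u • a • w = a • u • w := by
    intro u a w
    rw [← algebraMap_smul UVir a w, smul_smul, ← Algebra.commutes, mul_smul, algebraMap_smul]
  have central : ∀ w : W, uC • w = c • w := by
    intro w
    obtain ⟨u, rfl⟩ := hgen w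
    refine uvir_induction (p := fun u => uC • u • v = c • u • v) ?_ ?_ ?_ ?_ ?_ u
    · intro n u hu; rw [mul_smul, commC, hu, smulC]
    · intro u hu; rw [mul_smul, hu, smulC, hu]
    · rw [one_smul, hC]
    · intro u u' hu hu'; rw [add_smul, smul_add, hu, hu', smul_add]
    · intro a u hu; rw [smul_assoc, smulC, hu, smul_comm]
  refine ⟨central, fun w => ?_, ?_⟩
  · obtain ⟨u, rfl⟩ := hgen w
    refine uvir_induction (p := fun u => ∃ N : ℕ, ∀ n : ℤ, (N : ℤ) ≤ n → uL n • u • v = 0)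
      ?_ ?_ ?_ ?_ ?_ u
    · rintro m u ⟨N, hN⟩
      refine ⟨N + (N - m).toNat + (1 - m).toNat, fun n hn => ?_⟩
      rw [mul_smul, comm n m, hN n (by omega), hN (n + m) (by omega), if_neg (by omega)]
      simp
    · rintro u ⟨N, hN⟩
      refine ⟨N, fun n hn => ?_⟩
      rw [mul_smul, ← commC, hN n hn, smul_zero]
    · exact ⟨1, fun n hn => by rw [one_smul, hpos n (by exact_mod_cast hn)]⟩
    · rintro u u' ⟨N, hN⟩ ⟨N', hN'⟩
      refine ⟨N + N', fun n hn => ?_⟩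
      rw [add_smul, smul_add, hN n (by omega), hN' n (by omega), add_zero]
    · rintro a u ⟨N, hN⟩
      exact ⟨N, fun n hn => by rw [smul_assoc, smulC, hN n hn, smul_zero]⟩
  · rw [eq_top_iff]
    rintro w -
    obtain ⟨u, rfl⟩ := hgen w
    refine uvir_induction
      (p := fun u => u • v ∈ ⨆ h : ℂ, Module.End.eigenspace (Lop W 0) h) ?_ ?_ ?_ ?_ ?_ u
    · intro n u hu
      rw [mul_smul]
      refine Submodule.iSup_induction _ (motive := fun x =>
        uL n • x ∈ ⨆ h : ℂ, Module.End.eigenspace (Lop W 0) h) hu ?_ ?_ ?_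
      · intro a x hx
        refine Submodule.mem_iSup_of_mem (a - n) ?_
        rw [Module.End.mem_eigenspace_iff, Lop_apply] at hx ⊢
        rw [comm 0 n, hx, smulC, zero_add, sub_smul]
        split_ifs <;> simp [sub_eq_add_neg] <;> rw [add_smul, neg_smul]
      · rw [smul_zero]; exact Submodule.zero_mem _
      · intro x y hx hy; rw [smul_add]; exact Submodule.add_mem _ hx hy
    · intro u hu
      rw [mul_smul, central]; exact Submodule.smul_mem _ _ hu
    · rw [one_smul]
      exact Submodule.mem_iSup_of_mem h (Module.End.mem_eigenspace_iff.2 h0)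
    · intro u u' hu hu'; rw [add_smul]; exact Submodule.add_mem _ hu hu'
    · intro a u hu; rw [smul_assoc]; exact Submodule.smul_mem _ _ hu

/-- The left ideal `U(vir)(C - c) + U(vir)(L₀ - h) + ∑_{n ≥ 1} U(vir) Lₙ`. -/
def vermaIdeal (c h : ℂ) : Submodule UVir UVir :=
  Submodule.span UVir ({uC - algebraMap ℂ UVir c} ∪ {uL 0 - algebraMap ℂ UVir h} ∪
    {u | ∃ n : ℤ, 1 ≤ n ∧ u = uL n})

/-- The Verma module `M(c, h)`. -/
abbrev Verma (c h : ℂ) : Type := UVir ⧸ vermaIdeal c h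

/-- The maximal proper submodule of `M(c, h)`: the sum of all proper submodules. -/
def maxProper (c h : ℂ) : Submodule UVir (Verma c h) := sSup {N | N ≠ ⊤}

/-- The simple quotient of the Verma module `M(c, h)`. -/
def SimpleQuotient (c h : ℂ) : Type := Verma c h ⧸ maxProper c h

instance (c h : ℂ) : AddCommGroup (SimpleQuotient c h) :=
  inferInstanceAs (AddCommGroup (Verma c h ⧸ maxProper c h))

instance (c h : ℂ) : Module ℂ (SimpleQuotient c h) :=
  inferInstanceAs (Module ℂ (Verma c h ⧸ maxProper c h))

instance (c h : ℂ) : Module UVir (SimpleQuotient c h) :=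
  inferInstanceAs (Module UVir (Verma c h ⧸ maxProper c h))

instance (c h : ℂ) : IsScalarTower ℂ UVir (SimpleQuotient c h) :=
  inferInstanceAs (IsScalarTower ℂ UVir (Verma c h ⧸ maxProper c h))

/-- The image of `1 ∈ U(vir)` in the simple quotient of `M(c, h)`. -/
def SimpleQuotient.hw (c h : ℂ) : SimpleQuotient c h :=
  Submodule.Quotient.mk (p := maxProper c h) (Submodule.Quotient.mk (p := vermaIdeal c h) 1)

theorem smul_hw (c h : ℂ) (u : UVir) : u • SimpleQuotient.hw c h =
    (Submodule.Quotient.mk (p := maxProper c h) (Submodule.Quotient.mk (p := vermaIdeal c h) u) :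
      SimpleQuotient c h) := by
  have : u = u • 1 := by rw [smul_eq_mul, mul_one]
  conv_rhs => rw [this]
  rfl

theorem smul_hw_eq_zero (c h : ℂ) (u : UVir) (hu : u ∈ vermaIdeal c h) :
    u • SimpleQuotient.hw c h = 0 := by
  rw [smul_hw, (Submodule.Quotient.mk_eq_zero (vermaIdeal c h)).2 hu]
  rfl

instance (c h : ℂ) : IsSmoothVir c (SimpleQuotient c h) := by
  refine isSmoothVir_of_generator c h (SimpleQuotient.hw c h) ?_ ?_ ?_ ?_
  · intro w
    obtain ⟨x, rfl⟩ := Submodule.Quotient.mk_surjective (maxProper c h) w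
    obtain ⟨u, rfl⟩ := Submodule.Quotient.mk_surjective _ x
    exact ⟨u, smul_hw c h u⟩
  · have := smul_hw_eq_zero c h (uC - algebraMap ℂ UVir c)
      (Submodule.subset_span (Or.inl (Or.inl rfl)))
    rwa [sub_smul, algebraMap_smul, sub_eq_zero] at this
  · have := smul_hw_eq_zero c h (uL 0 - algebraMap ℂ UVir h)
      (Submodule.subset_span (Or.inl (Or.inr rfl)))
    rwa [sub_smul, algebraMap_smul, sub_eq_zero] at this
  · intro n hn
    exact smul_hw_eq_zero c h _ (Submodule.subset_span (Or.inr ⟨n, hn, rfl⟩))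

/-- The central charge `c(t) = 13 - 6 (t + t⁻¹)`. -/
def centralCharge (t : ℂ) : ℂ := 13 - 6 * (t + t⁻¹)

/-- The conformal weight `h_ℓ(t) = ℓ(ℓ+2)/4 t - ℓ/2` of the first row of the Kac table. -/
def kacWeight (t : ℂ) (l : ℕ) : ℂ := (l : ℂ) * (l + 2) / 4 * t - l / 2

/-- The first-row module `W_ℓ`, the simple quotient of `M(c(t), h_ℓ(t))`. -/
abbrev FirstRow (t : ℂ) (l : ℕ) : Type := SimpleQuotient (centralCharge t) (kacWeight t l)

/-- The highest weight vector `w_ℓ` of `W_ℓ`, the image of `1 ∈ U(vir)`. -/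
def hwVector (t : ℂ) (l : ℕ) : FirstRow t l := SimpleQuotient.hw _ _

/-! ### Direct sums, homomorphisms and completions -/

section DirectSum

open scoped DirectSum

variable {ι : Type*} (W : ι → Type*) [∀ i, AddCommGroup (W i)] [∀ i, Module ℂ (W i)]
  [∀ i, Module UVir (W i)] [∀ i, IsScalarTower ℂ UVir (W i)]

instance : IsScalarTower ℂ UVir (⨁ i, W i) :=
  inferInstanceAs (IsScalarTower ℂ UVir (Π₀ i, W i))

theorem directSum_Lop [DecidableEq ι] (n : ℤ) (i : ι) (w : W i) :
    Lop (⨁ i, W i) n (DirectSum.lof ℂ ι W i w) = DirectSum.lof ℂ ι W i (Lop (W i) n w) := by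
  rw [Lop_apply, Lop_apply]
  exact ((DirectSum.lof UVir ι W i).map_smul (uL n) w).symm

instance (c : ℂ) [∀ i, IsSmoothVir c (W i)] : IsSmoothVir c (⨁ i, W i) := by
  classical
  refine ⟨fun w => ?_, fun w => ?_, ?_⟩
  · refine DFinsupp.ext fun i => ?_
    exact IsSmoothVir.central (c := c) (w i)
  · induction w using DirectSum.induction_on with
    | zero => exact ⟨0, fun n _ => map_zero _⟩
    | of i x =>
      obtain ⟨N, hN⟩ := IsSmoothVir.smooth (c := c) x
      refine ⟨N, fun n hn => ?_⟩
      change Lop (⨁ i, W i) n (DirectSum.lof ℂ ι W i x) = 0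
      rw [directSum_Lop, hN n hn, map_zero]
    | add x y hx hy =>
      obtain ⟨N, hN⟩ := hx
      obtain ⟨M, hM⟩ := hy
      exact ⟨N + M, fun n hn => by rw [map_add, hN n (by omega), hM n (by omega), add_zero]⟩
  · rw [eq_top_iff]
    rintro w -
    induction w using DirectSum.induction_on with
    | zero => exact Submodule.zero_mem _
    | of i x =>
      have hx : x ∈ ⨆ h : ℂ, Module.End.eigenspace (Lop (W i) 0) h := by
        rw [IsSmoothVir.diagonalizable (c := c)]; trivial
      change DirectSum.lof ℂ ι W i x ∈ _
      refine Submodule.iSup_induction _ (motive := fun x => DirectSum.lof ℂ ι W i x ∈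
        ⨆ h : ℂ, Module.End.eigenspace (Lop (⨁ i, W i) 0) h) hx ?_ ?_ ?_
      · intro a y hy
        refine Submodule.mem_iSup_of_mem a ?_
        rw [Module.End.mem_eigenspace_iff] at hy ⊢
        rw [directSum_Lop, hy, map_smul]
      · rw [map_zero]; exact Submodule.zero_mem _
      · intro y z hy hz; rw [map_add]; exact Submodule.add_mem _ hy hz
    | add x y hx hy => exact Submodule.add_mem _ hx hy

end DirectSum

theorem finite₂ {W₁ W₂ W₃ : Type*} [AddCommGroup W₁] [Module ℂ W₁]
    [AddCommGroup W₂] [Module ℂ W₂] [AddCommGroup W₃] [Module ℂ W₃]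
    (𝒴 : ℂ → W₁ →ₗ[ℂ] W₂ →ₗ[ℂ] W₃) (b : VertexOperator ℂ W₂)
    (w₁ : W₁) (w₂ : W₂) (m : ℤ) (a : ℕ → ℂ) (d : ℕ → ℂ) :
    Function.HasFiniteSupport fun i : ℕ => a i • 𝒴 (d i) w₁ (mode b (m + i) w₂) := by
  obtain ⟨N, hN⟩ := trunc_nat b m w₂
  exact (Set.finite_Iio N).subset fun i hi => by
    by_contra h; exact hi (by dsimp only; rw [hN i (by simpa using h), map_zero, smul_zero])

theorem finite₃ {W₁ W₂ W₃ : Type*} [AddCommGroup W₁] [Module ℂ W₁]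
    [AddCommGroup W₂] [Module ℂ W₂] [AddCommGroup W₃] [Module ℂ W₃]
    (𝒴 : ℂ → W₁ →ₗ[ℂ] W₂ →ₗ[ℂ] W₃) (b : VertexOperator ℂ W₁)
    (w₁ : W₁) (w₂ : W₂) (l : ℤ) (a : ℕ → ℂ) (d : ℕ → ℂ) :
    Function.HasFiniteSupport fun i : ℕ => a i • 𝒴 (d i) (mode b (l + i) w₁) w₂ := by
  obtain ⟨N, hN⟩ := trunc_nat b l w₁
  exact (Set.finite_Iio N).subset fun i hi => by
    by_contra h
    exact hi (by
      dsimp only; rw [hN i (by simpa using h), map_zero, LinearMap.zero_apply, smul_zero])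

section Modules

variable (c : ℂ)
variable (W₁ : Type*) [AddCommGroup W₁] [Module ℂ W₁] [Module UVir W₁] [IsScalarTower ℂ UVir W₁]
  [IsSmoothVir c W₁]
variable (W₂ : Type*) [AddCommGroup W₂] [Module ℂ W₂] [Module UVir W₂] [IsScalarTower ℂ UVir W₂]
  [IsSmoothVir c W₂]
variable (W₃ : Type*) [AddCommGroup W₃] [Module ℂ W₃] [Module UVir W₃] [IsScalarTower ℂ UVir W₃]
  [IsSmoothVir c W₃]
variable (W₄ : Type*) [AddCommGroup W₄] [Module ℂ W₄] [Module UVir W₄] [IsScalarTower ℂ UVir W₄]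
  [IsSmoothVir c W₄]

/-- Homomorphisms of `V_c`-modules: linear maps which commute with all the vertex operators
`Y(v, x)`, `v ∈ V_c`. -/
structure VOAHom extends W₁ →ₗ[ℂ] W₂ where
  map_vertexOp : ∀ (v : VirVOA c) (k : ℤ) (w : W₁),
    toFun (mode (vertexOp c W₁ v) k w) = mode (vertexOp c W₂ v) k (toFun w)

variable {W₁ W₂}

theorem VOAHom.map_Lop (f : VOAHom c W₁ W₂) (n : ℤ) (w : W₁) :
    f.toLinearMap (Lop W₁ n w) = Lop W₂ n (f.toLinearMap w) := by
  rw [← vertexOp_conformalVector c, ← vertexOp_conformalVector c]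
  exact f.map_vertexOp _ _ _

theorem map_fieldOp (f : W₁ →ₗ[UVir] W₂) (n : ℤ) (a : VertexOperator ℂ W₁)
    (b : VertexOperator ℂ W₂) (h : ∀ k w, f (mode a k w) = mode b k (f w)) (k : ℤ) (w : W₁) :
    f (mode (fieldOp c W₁ n a) k w) = mode (fieldOp c W₂ n b) k (f w) := by
  have hL : ∀ n w, f (Lop W₁ n w) = Lop W₂ n (f w) := fun n w => f.map_smul (uL n) w
  have hf : ∀ (r : ℂ) w, f (r • w) = r • f w := fun r w => by
    rw [← algebraMap_smul UVir r w, f.map_smul, algebraMap_smul]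
  rw [fieldOp, fieldOp, LinearMap.sub_apply, LinearMap.sub_apply, mode_sub, mode_sub, map_sub]
  congr 1
  · obtain ⟨N, hN⟩ := trunc_nat a k w
    change f (mode (leftPart n a) k w) = mode (leftPart n b) k (f w)
    rw [leftPart_mode n a k w N hN, leftPart_mode n b k (f w) N fun j hj => by
      rw [← h, hN j hj, map_zero], map_sum]
    refine Finset.sum_congr rfl fun j _ => ?_
    rw [hf, hL, h]
  · obtain ⟨N, hN⟩ := smooth_nat c w
    change f (mode (rightPart c n a) k w) = mode (rightPart c n b) k (f w)
    rw [rightPart_mode c n a k w N hN, rightPart_mode c n b k (f w) N fun j hj => by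
      rw [← hL, hN j hj, map_zero], map_sum]
    refine Finset.sum_congr rfl fun j _ => ?_
    rw [hf, h, hL]

/-- A homomorphism of representations of the Virasoro algebra is a homomorphism of
`V_c`-modules. -/
def VOAHom.ofUVir (f : W₁ →ₗ[UVir] W₂) : VOAHom c W₁ W₂ where
  toLinearMap := f.restrictScalars ℂ
  map_vertexOp v := by
    obtain ⟨u, rfl⟩ := Submodule.Quotient.mk_surjective _ v
    change ∀ k w, f (mode (vertexOp c W₁ _) k w) = mode (vertexOp c W₂ _) k (f w)
    have hf : ∀ (r : ℂ) w, f (r • w) = r • f w := fun r w => by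
      rw [← algebraMap_smul UVir r w, f.map_smul, algebraMap_smul]
    simp only [vertexOp_mk]
    refine uvir_induction (p := fun u => ∀ k w, f (mode (fieldAct c W₁ u (idField W₁)) k w) =
      mode (fieldAct c W₂ u (idField W₂)) k (f w)) ?_ ?_ ?_ ?_ ?_ u
    · intro n u hu k w
      rw [map_mul, map_mul, Module.End.mul_apply, Module.End.mul_apply, fieldAct_uL, fieldAct_uL]
      exact map_fieldOp c f n _ _ hu k w
    · intro u hu k w
      rw [map_mul, map_mul, Module.End.mul_apply, Module.End.mul_apply, fieldAct_uC, fieldAct_uC,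
        LinearMap.smul_apply, LinearMap.smul_apply, Module.End.one_apply, Module.End.one_apply,
        mode_smul, mode_smul, hf, hu]
    · intro k w
      rw [map_one, map_one, Module.End.one_apply, Module.End.one_apply, idField_mode, idField_mode]
      split_ifs <;> simp
    · intro u u' hu hu' k w
      rw [map_add, map_add, LinearMap.add_apply, LinearMap.add_apply, mode_add, mode_add, map_add,
        hu, hu']
    · intro r u hu k w
      rw [map_smul, map_smul, LinearMap.smul_apply, LinearMap.smul_apply, mode_smul, mode_smul,
        hf, hu]

/-- The space `W_{[h]}` of vectors of conformal weight `h`. -/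
abbrev weightSpace (W : Type*) [AddCommGroup W] [Module ℂ W] [Module UVir W]
    [IsScalarTower ℂ UVir W] (h : ℂ) : Submodule ℂ W :=
  Module.End.eigenspace (Lop W 0) h

theorem isInternal_weightSpace (W : Type*) [AddCommGroup W] [Module ℂ W] [Module UVir W]
    [IsScalarTower ℂ UVir W] [IsSmoothVir c W] : DirectSum.IsInternal (weightSpace W) :=
  DirectSum.isInternal_submodule_of_iSupIndep_of_iSup_eq_top
    (Module.End.eigenspaces_iSupIndep (Lop W 0)) (IsSmoothVir.diagonalizable (c := c))

/-- The projection of `W = ⨁_h W_{[h]}` onto `W_{[h]}`. -/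
def weightProj (W : Type*) [AddCommGroup W] [Module ℂ W] [Module UVir W]
    [IsScalarTower ℂ UVir W] [IsSmoothVir c W] (h : ℂ) : W →ₗ[ℂ] weightSpace W h :=
  (DirectSum.component ℂ ℂ (fun h => weightSpace W h) h).comp
    (LinearEquiv.ofBijective (DirectSum.coeLinearMap (weightSpace W))
      (isInternal_weightSpace c W)).symm.toLinearMap

/-- The algebraic completion `∏_h W_{[h]}` of `W = ⨁_h W_{[h]}`. -/
abbrev Completion (W : Type*) [AddCommGroup W] [Module ℂ W] [Module UVir W]
    [IsScalarTower ℂ UVir W] : Type _ :=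
  (h : ℂ) → weightSpace W h

/-- The extension of a homomorphism to the completions. -/
def VOAHom.completion (f : VOAHom c W₁ W₂) (u : Completion W₁) : Completion W₂ := fun h =>
  ⟨f.toLinearMap (u h), by
    have := Module.End.mem_eigenspace_iff.1 (u h).2
    rw [Module.End.mem_eigenspace_iff, ← f.map_Lop, this, map_smul]⟩

/-! ### Intertwining operators -/

variable {W₃ W₄}

/-- The conditions for a family `(w₁)_n w₂`, `n ∈ ℂ`, to be the modes of an intertwining operator
`𝒴(w₁, x) w₂ = ∑_{n ∈ ℂ} (w₁)_n w₂ x^{-n-1}`. -/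
structure IsIntertwining (𝒴 : ℂ → W₁ →ₗ[ℂ] W₂ →ₗ[ℂ] W₃) : Prop where
  /-- Lower truncation: the powers of `x` in `𝒴(w₁, x) w₂` are bounded below in each coset
  of `ℤ`. -/
  truncation : ∀ (w₁ : W₁) (w₂ : W₂) (n : ℂ), ∃ N : ℕ, ∀ k : ℕ, N ≤ k → 𝒴 (n + k) w₁ w₂ = 0
  /-- The Jacobi identity, in components: the coefficients of
  `x₀^{-l-1} x₁^{-m-1} x₂^{-n-1}` in
  `x₀⁻¹ δ((x₁-x₂)/x₀) Y(v,x₁) 𝒴(w₁,x₂) w₂ - x₀⁻¹ δ((x₂-x₁)/(-x₀)) 𝒴(w₁,x₂) Y(v,x₁) w₂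
    = x₂⁻¹ δ((x₁-x₀)/x₂) 𝒴(Y(v,x₀) w₁,x₂) w₂`. -/
  jacobi : ∀ (v : VirVOA c) (w₁ : W₁) (w₂ : W₂) (l m : ℤ) (n : ℂ),
    ∑ᶠ i : ℕ, ((-1 : ℂ) ^ i * binom l i) •
        mode (vertexOp c W₃ v) (m + l - i) (𝒴 (n + i) w₁ w₂) -
      ∑ᶠ i : ℕ, ((-1 : ℂ) ^ (l + i) * binom l i) •
        𝒴 (n + l - i) w₁ (mode (vertexOp c W₂ v) (m + i) w₂) =
    ∑ᶠ i : ℕ, binom m i • 𝒴 (m + n - i) (mode (vertexOp c W₁ v) (l + i) w₁) w₂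
  /-- The `L₋₁`-derivation property `𝒴(L₋₁ w₁, x) = d/dx 𝒴(w₁, x)`. -/
  derivation : ∀ (w₁ : W₁) (w₂ : W₂) (n : ℂ), 𝒴 n (Lop W₁ (-1) w₁) w₂ = -n • 𝒴 (n - 1) w₁ w₂

theorem IsIntertwining.zero : IsIntertwining c (0 : ℂ → W₁ →ₗ[ℂ] W₂ →ₗ[ℂ] W₃) where
  truncation _ _ _ := ⟨0, fun _ _ => rfl⟩
  jacobi v w₁ w₂ l m n := by simp
  derivation w₁ w₂ n := by simp

theorem IsIntertwining.finite₁ {𝒴 : ℂ → W₁ →ₗ[ℂ] W₂ →ₗ[ℂ] W₃} (h : IsIntertwining c 𝒴)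
    (w₁ : W₁) (w₂ : W₂) (n : ℂ) (a : ℕ → ℂ)
    (b : ℕ → Module.End ℂ W₃) :
    Function.HasFiniteSupport fun i : ℕ => a i • b i (𝒴 (n + i) w₁ w₂) := by
  obtain ⟨N, hN⟩ := h.truncation w₁ w₂ n
  exact (Set.finite_Iio N).subset fun i hi => by
    by_contra h; exact hi (by dsimp only; rw [hN i (by simpa using h), map_zero, smul_zero])

theorem IsIntertwining.add {𝒴 𝒵 : ℂ → W₁ →ₗ[ℂ] W₂ →ₗ[ℂ] W₃} (h : IsIntertwining c 𝒴)
    (h' : IsIntertwining c 𝒵) : IsIntertwining c (𝒴 + 𝒵) where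
  truncation w₁ w₂ n := by
    obtain ⟨N, hN⟩ := h.truncation w₁ w₂ n
    obtain ⟨M, hM⟩ := h'.truncation w₁ w₂ n
    exact ⟨N + M, fun k hk => by
      simp [hN k (by omega), hM k (by omega)]⟩
  jacobi v w₁ w₂ l m n := by
    simp only [Pi.add_apply, LinearMap.add_apply, map_add, smul_add]
    have h1 := fun {𝒳 : ℂ → W₁ →ₗ[ℂ] W₂ →ₗ[ℂ] W₃} (hX : IsIntertwining c 𝒳) =>
      hX.finite₁ c w₁ w₂ n (fun i => (-1 : ℂ) ^ i * binom l i)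
        fun i => mode (vertexOp c W₃ v) (m + l - i)
    have h2 := fun 𝒳 : ℂ → W₁ →ₗ[ℂ] W₂ →ₗ[ℂ] W₃ => finite₂ 𝒳 (vertexOp c W₂ v) w₁ w₂ m
      (fun i => (-1 : ℂ) ^ (l + i) * binom l i) fun i => n + l - i
    have h3 := fun 𝒳 : ℂ → W₁ →ₗ[ℂ] W₂ →ₗ[ℂ] W₃ => finite₃ 𝒳 (vertexOp c W₁ v) w₁ w₂ l
      (fun i => binom m i) fun i => m + n - i
    rw [finsum_add_distrib (h1 h) (h1 h'), finsum_add_distrib (h2 _) (h2 _),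
      finsum_add_distrib (h3 _) (h3 _), ← h.jacobi, ← h'.jacobi]
    abel
  derivation w₁ w₂ n := by
    simp only [Pi.add_apply, LinearMap.add_apply, h.derivation, h'.derivation, smul_add]

theorem IsIntertwining.smul {𝒴 : ℂ → W₁ →ₗ[ℂ] W₂ →ₗ[ℂ] W₃} (h : IsIntertwining c 𝒴)
    (r : ℂ) : IsIntertwining c (r • 𝒴) where
  truncation w₁ w₂ n := by
    obtain ⟨N, hN⟩ := h.truncation w₁ w₂ n
    exact ⟨N, fun k hk => by simp [hN k hk]⟩
  jacobi v w₁ w₂ l m n := by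
    simp only [Pi.smul_apply, LinearMap.smul_apply, map_smul, smul_comm _ r]
    rw [← smul_finsum, ← smul_finsum, ← smul_finsum, ← h.jacobi, smul_sub]
  derivation w₁ w₂ n := by
    simp only [Pi.smul_apply, LinearMap.smul_apply, h.derivation, smul_comm _ r]

variable (W₁ W₂ W₃) in
/-- The vector space of intertwining operators of type `(W₃ over W₁ W₂)`, described through their
modes. -/
def Intertwiners : Submodule ℂ (ℂ → W₁ →ₗ[ℂ] W₂ →ₗ[ℂ] W₃) where
  carrier := {𝒴 | IsIntertwining c 𝒴}
  add_mem' h h' := h.add c h'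
  zero_mem' := IsIntertwining.zero c
  smul_mem' r _ h := h.smul c r

/-- The composition of an intertwining operator with a homomorphism of `V_c`-modules. -/
def Intertwiners.comp (f : VOAHom c W₃ W₄) (𝒴 : Intertwiners c W₁ W₂ W₃) :
    Intertwiners c W₁ W₂ W₄ :=
  ⟨fun n => (𝒴.1 n).compr₂ f.toLinearMap, by
    have h : IsIntertwining c 𝒴.1 := 𝒴.2
    refine ⟨fun w₁ w₂ n => ?_, fun v w₁ w₂ l m n => ?_, fun w₁ w₂ n => ?_⟩
    · obtain ⟨N, hN⟩ := h.truncation w₁ w₂ n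
      exact ⟨N, fun k hk => by rw [LinearMap.compr₂_apply, hN k hk, map_zero]⟩
    · have hf : ∀ k w, mode (vertexOp c W₄ v) k (f.toLinearMap w) =
        f.toLinearMap (mode (vertexOp c W₃ v) k w) := fun k w => (f.map_vertexOp v k w).symm
      simp only [LinearMap.compr₂_apply, hf, ← f.toLinearMap.map_smul]
      have e1 := f.toLinearMap.toAddMonoidHom.map_finsum
        (h.finite₁ c w₁ w₂ n (fun i => (-1 : ℂ) ^ i * binom l i)
          fun i => mode (vertexOp c W₃ v) (m + l - i))
      have e2 := f.toLinearMap.toAddMonoidHom.map_finsum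
        (finite₂ 𝒴.1 (vertexOp c W₂ v) w₁ w₂ m (fun i => (-1 : ℂ) ^ (l + i) * binom l i)
          fun i => n + l - i)
      have e3 := f.toLinearMap.toAddMonoidHom.map_finsum
        (finite₃ 𝒴.1 (vertexOp c W₁ v) w₁ w₂ l (fun i => binom m i) fun i => m + n - i)
      have := congrArg f.toLinearMap (h.jacobi v w₁ w₂ l m n)
      rw [map_sub] at this
      exact (congrArg₂ (· - ·) e1 e2).symm.trans (this.trans e3)
    · rw [LinearMap.compr₂_apply, LinearMap.compr₂_apply, h.derivation, map_smul]⟩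

/-- The evaluation `𝒴(w₁, x) w₂` at `x = e^ζ`, in the completion of `W₃`: each power `x^α` is
replaced by `e^{α ζ}`. -/
def evalAt (𝒴 : Intertwiners c W₁ W₂ W₃) (ζ : ℂ) (w₁ : W₁) (w₂ : W₂) : Completion W₃ := fun h =>
  ∑ᶠ n : ℂ, Complex.exp ((-n - 1) * ζ) • weightProj c W₃ h (𝒴.1 n w₁ w₂)

end Modules

/-! ### Branches of the logarithm -/

/-- `log z` with `arg z ∈ [0, 2π)`. -/
def logBranch (z : ℂ) : ℂ := ⟨Real.log ‖z‖, toIcoMod Real.two_pi_pos 0 z.arg⟩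

theorem exp_logBranch {z : ℂ} (hz : z ≠ 0) : Complex.exp (logBranch z) = z := by
  have h : logBranch z = Complex.log z +
      ((-toIcoDiv Real.two_pi_pos 0 z.arg : ℤ) : ℂ) * (2 * Real.pi * Complex.I) := by
    apply Complex.ext
    · simp [logBranch, Complex.log_re]
    · have h1 : toIcoMod Real.two_pi_pos 0 z.arg =
          z.arg - toIcoDiv Real.two_pi_pos 0 z.arg • (2 * Real.pi) := rfl
      change toIcoMod Real.two_pi_pos 0 z.arg = _
      rw [h1, zsmul_eq_mul]
      generalize toIcoDiv Real.two_pi_pos 0 z.arg = k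
      simp [Complex.log_im]
      ring
  rw [h, Complex.exp_add, Complex.exp_int_mul_two_pi_mul_I, mul_one, Complex.exp_log hz]

/-- `l_γ(z₁)` for a path `γ` from `z₁` to `z₂` in `ℂ^×`: the value at `z₁` of the logarithm
continued analytically along `γ` from the value `log z₂`, `arg z₂ ∈ [0, 2π)`, at `z₂`. It is the
end point of the lift of the reversed path along `exp : ℂ → ℂ^×` starting from `log z₂`. -/
def logAlong {z₁ z₂ : {z : ℂ // z ≠ 0}} (γ : Path z₁ z₂) : ℂ :=
  Complex.isCoveringMap_exp.liftPath (γ.symm : C(unitInterval, {z : ℂ // z ≠ 0}))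
    (logBranch z₂) (Subtype.ext (by
      change (γ.symm 0 : {z : ℂ // z ≠ 0}).1 = _
      rw [γ.symm.source]
      exact (exp_logBranch z₂.2).symm)) 1

section Transport

variable (c : ℂ)
variable {W₁ : Type*} [AddCommGroup W₁] [Module ℂ W₁] [Module UVir W₁] [IsScalarTower ℂ UVir W₁]
  [IsSmoothVir c W₁]
variable {W₂ : Type*} [AddCommGroup W₂] [Module ℂ W₂] [Module UVir W₂] [IsScalarTower ℂ UVir W₂]
  [IsSmoothVir c W₂]
variable {U₁ : Type*} [AddCommGroup U₁] [Module ℂ U₁] [Module UVir U₁] [IsScalarTower ℂ UVir U₁]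
  [IsSmoothVir c U₁]
variable {U₂ : Type*} [AddCommGroup U₂] [Module ℂ U₂] [Module UVir U₂] [IsScalarTower ℂ UVir U₂]
  [IsSmoothVir c U₂]

/-- The `P(z)`-intertwining map `w₁ ⊗ w₂ ↦ 𝒴(w₁, z) w₂` attached to an intertwining operator,
the branch being `arg z ∈ [0, 2π)`. -/
def intertwiningMap (𝒴 : Intertwiners c W₁ W₂ U₁) (z : ℂ) (w₁ : W₁) (w₂ : W₂) : Completion U₁ :=
  evalAt c 𝒴 (logBranch z) w₁ w₂

/-- Let `U₁ = W₁ ⊠_{P(z₁)} W₂` with `w₁ ⊠_{P(z₁)} w₂ = 𝒴₁(w₁, z₁) w₂`, let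
`U₂ = W₁ ⊠_{P(z₂)} W₂` with `w₁ ⊠_{P(z₂)} w₂ = 𝒴₂(w₁, z₂) w₂`, and let `γ` be a path from `z₁` to
`z₂` in `ℂ^×`. The homomorphism `T : U₁ → U₂` is the parallel transport along `γ` if
`T̄ (w₁ ⊠_{P(z₁)} w₂) = 𝒴₂(w₁, x) w₂` at `x = e^{l_γ(z₁)}` for all `w₁`, `w₂`. -/
def IsParallelTransport {z₁ z₂ : {z : ℂ // z ≠ 0}} (γ : Path z₁ z₂)
    (𝒴₁ : Intertwiners c W₁ W₂ U₁) (𝒴₂ : Intertwiners c W₁ W₂ U₂) (T : VOAHom c U₁ U₂) : Prop :=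
  ∀ (w₁ : W₁) (w₂ : W₂),
    T.completion c (intertwiningMap c 𝒴₁ z₁ w₁ w₂) = evalAt c 𝒴₂ (logAlong γ) w₁ w₂

end Transport

/-! ### The realization of the tensor products of first-row modules -/

/-- The selection rule set `Sel(ℓ₁, ℓ₂)`. -/
def Sel (l₁ l₂ : ℕ) : Finset ℕ :=
  {l ∈ Finset.range (l₁ + l₂ + 1) | |(l₁ : ℤ) - l₂| ≤ l ∧ Even (l + l₁ + l₂)}

/-- The normalization constant `B_{ℓ₁ ℓ₂}^ℓ`, where `s = (ℓ₁ + ℓ₂ - ℓ)/2`. -/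
def normConst (t : ℂ) (l₁ l₂ l : ℕ) : ℂ :=
  1 / (((l₁ + l₂ - l) / 2).factorial : ℂ) * ∏ j ∈ Finset.Icc 1 ((l₁ + l₂ - l) / 2),
    Complex.Gamma (1 + t * j) * Complex.Gamma (1 - t * (l₁ + 1 - j)) *
      Complex.Gamma (1 - t * (l₂ + 1 - j)) /
    (Complex.Gamma (1 + t) *
      Complex.Gamma (2 - t * (2 - j + l₁ + l₂ - (((l₁ + l₂ - l) / 2 : ℕ) : ℂ))))

/-- The normalization
`𝒴(w_{ℓ₁}, x) w_{ℓ₂} ∈ B_{ℓ₁ ℓ₂}^ℓ w_ℓ x^{h_ℓ-h_{ℓ₁}-h_{ℓ₂}} + W_ℓ[[x]] x^{h_ℓ-h_{ℓ₁}-h_{ℓ₂}+1}`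
of an intertwining operator of type `(W_ℓ over W_{ℓ₁} W_{ℓ₂})`; the coefficient of `x^α` is the
mode of index `-α - 1`. -/
def IsNormalized (t : ℂ) (l₁ l₂ l : ℕ)
    (𝒴 : Intertwiners (centralCharge t) (FirstRow t l₁) (FirstRow t l₂) (FirstRow t l)) : Prop :=
  𝒴.1 (-(kacWeight t l - kacWeight t l₁ - kacWeight t l₂) - 1) (hwVector t l₁) (hwVector t l₂) =
      normConst t l₁ l₂ l • hwVector t l ∧
    ∀ α : ℂ, (∀ k : ℕ, α ≠ kacWeight t l - kacWeight t l₁ - kacWeight t l₂ + k) →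
      𝒴.1 (-α - 1) (hwVector t l₁) (hwVector t l₂) = 0

open scoped DirectSum in
/-- The object `⨁_{ℓ ∈ Sel(ℓ₁, ℓ₂)} W_ℓ` which realizes `W_{ℓ₁} ⊠_{P(z)} W_{ℓ₂}` for all `z`. -/
abbrev TensorObj (t : ℂ) (l₁ l₂ : ℕ) : Type := ⨁ l : Sel l₁ l₂, FirstRow t l

/-- The inclusion of the component `W_ℓ`. -/
def tensorIncl (t : ℂ) (l₁ l₂ : ℕ) (l : Sel l₁ l₂) :
    VOAHom (centralCharge t) (FirstRow t l) (TensorObj t l₁ l₂) :=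
  VOAHom.ofUVir _ (DirectSum.lof UVir (Sel l₁ l₂) (fun l => FirstRow t l) l)

/-- The intertwining operator `∑_{ℓ ∈ Sel(ℓ₁, ℓ₂)} 𝒴_{ℓ₁ ℓ₂}^ℓ` whose value at `z` is the
intertwining map of the realization of `W_{ℓ₁} ⊠_{P(z)} W_{ℓ₂}`. -/
def tensorOp (t : ℂ) (l₁ l₂ : ℕ) (𝒴 : (l : Sel l₁ l₂) →
      Intertwiners (centralCharge t) (FirstRow t l₁) (FirstRow t l₂) (FirstRow t l)) :
    Intertwiners (centralCharge t) (FirstRow t l₁) (FirstRow t l₂) (TensorObj t l₁ l₂) :=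
  ∑ l, Intertwiners.comp (centralCharge t) (tensorIncl t l₁ l₂ l) (𝒴 l)

end FirstRowVirasoro

end

open FirstRowVirasoro

noncomputable section

namespace FirstRowVirasoro

/-! ### Projections onto weight spaces -/

section WeightProjection

variable (c : ℂ) {W : Type*} [AddCommGroup W] [Module ℂ W] [Module UVir W]
  [IsScalarTower ℂ UVir W] [IsSmoothVir c W]

/-! The branch hypothesis reduces everything to one evaluation point. The number `logAlong γ` is a
logarithm of `z₁`, so its real part is forced to be `log ‖z₁‖`; with the prescribed imaginary part
it equals `logBranch z₁` (`logAlong_eq_logBranch`). The defining equation of the transport then says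
that `T` fixes every value `𝒴_⊠(w₁, e^{log z₁}) w₂`, which the identity does. What remains is that
nothing else does.

For uniqueness it is enough to test the equation on the two highest weight vectors, one weight at a
time. The commutator of `L₀` with an intertwining operator makes every mode of homogeneous vectors
homogeneous, so the weight `h` part of the evaluation is a single mode times an exponential
(`evalAt_of_mem_weightSpace`). Take `h = h_ℓ`. For `ℓ' ≠ ℓ` the difference `h_ℓ - h_ℓ'` is a nonzero
rational multiple of `t` plus a rational number, hence not a natural number, so the summand `𝒴^{ℓ'}`
contributes nothing in this weight. The weight `h_ℓ` part is therefore an exponential times `B^ℓ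
w_ℓ` (`evalAt_tensorOp_hwVector`).

The constant `B^ℓ` is not zero: irrationality of `t` keeps all the Gamma arguments away from the
poles (`normConst_ne_zero`). So a transport `T` fixes each `w_ℓ`. A homomorphism of `V_c`-modules
commutes with `U(vir)`, because the modes of the conformal vector are the `Lₙ` and `C` acts by `c`
(`VOAHom.map_smul_uvir`). As `w_ℓ` generates `W_ℓ`, `T` is the identity on each summand
(`VOAHom.eq_id_of_tensorIncl_hwVector`). -/

theorem weightProj_of_mem {h h' : ℂ} {w : W} (hw : w ∈ weightSpace W h') :
    (weightProj c W h w : W) = if h = h' then w else 0 := by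
  classical
  have e : (LinearEquiv.ofBijective (DirectSum.coeLinearMap (weightSpace W))
      (isInternal_weightSpace c W)).symm w =
      DirectSum.lof ℂ ℂ (fun h => weightSpace W h) h' ⟨w, hw⟩ := by
    rw [LinearEquiv.symm_apply_eq]
    exact (DirectSum.coeLinearMap_lof (weightSpace W) h' ⟨w, hw⟩).symm
  have e' : weightProj c W h w =
      DirectSum.component ℂ ℂ (fun h => weightSpace W h) h
        (DirectSum.lof ℂ ℂ (fun h => weightSpace W h) h' ⟨w, hw⟩) := by
    rw [← e]; rfl
  rw [e']
  split_ifs with hh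
  · subst hh
    rw [DirectSum.component.lof_self]
  · rw [DirectSum.component.of, dif_neg (Ne.symm hh)]
    rfl

end WeightProjection

/-! ### Weights of intertwining operators, and homomorphisms as `U(vir)`-maps -/

section Intertwining

variable (c : ℂ)
variable {W₁ : Type*} [AddCommGroup W₁] [Module ℂ W₁] [Module UVir W₁] [IsScalarTower ℂ UVir W₁]
  [IsSmoothVir c W₁]
variable {W₂ : Type*} [AddCommGroup W₂] [Module ℂ W₂] [Module UVir W₂] [IsScalarTower ℂ UVir W₂]
  [IsSmoothVir c W₂]
variable {W₃ : Type*} [AddCommGroup W₃] [Module ℂ W₃] [Module UVir W₃] [IsScalarTower ℂ UVir W₃]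
  [IsSmoothVir c W₃]

theorem binom_zero_left {i : ℕ} (hi : i ≠ 0) : binom 0 i = 0 := by
  have h := Ring.choose_natCast (R := ℤ) 0 i
  rw [Nat.choose_eq_zero_of_lt (Nat.pos_of_ne_zero hi)] at h
  simpa [binom] using h

theorem binom_one_left (i : ℕ) : binom 1 i = (Nat.choose 1 i : ℂ) := by
  have h := Ring.choose_natCast (R := ℤ) 1 i
  rw [Nat.cast_one] at h
  rw [binom, h, Int.cast_natCast]

/-- The commutator formula of `L₀` with the modes of an intertwining operator. -/
theorem IsIntertwining.Lop_zero {𝒴 : ℂ → W₁ →ₗ[ℂ] W₂ →ₗ[ℂ] W₃} (h : IsIntertwining c 𝒴)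
    (n : ℂ) (w₁ : W₁) (w₂ : W₂) :
    Lop W₃ 0 (𝒴 n w₁ w₂) =
      𝒴 n w₁ (Lop W₂ 0 w₂) + 𝒴 n (Lop W₁ 0 w₁) w₂ - (n + 1) • 𝒴 n w₁ w₂ := by
  -- With `v = ω`, `l = 0` and `m = 1`, the factors `binom 0 i` leave only `i = 0` in the two sums
  -- on the left, where the mode `ω_1` is `L₀`. The factors `binom 1 i` leave `i = 0, 1` on the
  -- right, where `ω_0` and `ω_1` are `L₋₁` and `L₀`.
  have J := h.jacobi (conformalVector c) w₁ w₂ 0 1 n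
  rw [finsum_eq_sum_range _ 1 fun i hi => by
      rw [binom_zero_left (by omega), mul_zero, zero_smul],
    finsum_eq_sum_range _ 1 fun i hi => by
      rw [binom_zero_left (by omega), mul_zero, zero_smul],
    finsum_eq_sum_range _ 2 fun i hi => by
      rw [binom_one_left, Nat.choose_eq_zero_of_lt (by omega), Nat.cast_zero, zero_smul]] at J
  have m3 := vertexOp_conformalVector c (W := W₃) 0 (𝒴 n w₁ w₂)
  have m2 := vertexOp_conformalVector c (W := W₂) 0 w₂
  have m1 := vertexOp_conformalVector c (W := W₁) 0 w₁
  have m0 := vertexOp_conformalVector c (W := W₁) (-1) w₁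
  norm_num at m3 m2 m1 m0
  simp only [Finset.sum_range_succ, Finset.sum_range_zero, zero_add, binom_one_left,
    binom_zero] at J
  norm_num at J
  -- The `L₋₁` term sits at mode index `1 + n`, so the derivation property turns it into `-(1 + n)`
  -- times the mode of index `n`.
  rw [m3, m2, m1, m0, h.derivation] at J
  rw [sub_eq_iff_eq_add] at J
  rw [J, show (1 : ℂ) + n - 1 = n by ring]
  module

/-- Inserting the two eigenvalues into the `L₀` commutator formula leaves a scalar: the mode of
index `n` shifts the total weight by `-n - 1`. -/
theorem Intertwiners.mem_weightSpace (𝒴 : Intertwiners c W₁ W₂ W₃) {h₁ h₂ : ℂ} {w₁ : W₁}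
    {w₂ : W₂} (hw₁ : w₁ ∈ weightSpace W₁ h₁) (hw₂ : w₂ ∈ weightSpace W₂ h₂) (n : ℂ) :
    𝒴.1 n w₁ w₂ ∈ weightSpace W₃ (h₁ + h₂ - n - 1) := by
  rw [Module.End.mem_eigenspace_iff] at *
  have h : IsIntertwining c 𝒴.1 := 𝒴.2
  rw [h.Lop_zero c, hw₁, hw₂, map_smul, map_smul, LinearMap.smul_apply]
  module

/-- The component of weight `h` of `𝒴(w₁, e^ζ) w₂` for homogeneous `w₁` and `w₂`. -/
theorem evalAt_of_mem_weightSpace (𝒴 : Intertwiners c W₁ W₂ W₃) {h₁ h₂ : ℂ} {w₁ : W₁}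
    {w₂ : W₂} (hw₁ : w₁ ∈ weightSpace W₁ h₁) (hw₂ : w₂ ∈ weightSpace W₂ h₂) (ζ h : ℂ) :
    (evalAt c 𝒴 ζ w₁ w₂ h : W₃) =
      Complex.exp ((h - h₁ - h₂) * ζ) • 𝒴.1 (-(h - h₁ - h₂) - 1) w₁ w₂ := by
  have hm := Intertwiners.mem_weightSpace c 𝒴 hw₁ hw₂
  -- The index is the solution `n` of `h₁ + h₂ - n - 1 = h`. All other modes have a different weight
  -- and project to zero, so the support has at most one point and `finsum` does not fall back on
  -- its default value.
  rw [evalAt, finsum_eq_single _ (-(h - h₁ - h₂) - 1)]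
  · rw [Submodule.coe_smul, weightProj_of_mem c (hm _), if_pos (by ring)]
    congr 3
    ring
  · intro n hn
    have : weightProj c W₃ h (𝒴.1 n w₁ w₂) = 0 := by
      refine Subtype.ext ?_
      rw [weightProj_of_mem c (hm n), if_neg]
      · rfl
      · intro e
        apply hn
        rw [e]; ring
    rw [this, smul_zero]

variable (W₁) in
/-- The identity homomorphism. -/
def VOAHom.id : VOAHom c W₁ W₁ := ⟨LinearMap.id, fun _ _ _ => rfl⟩

theorem VOAHom.completion_id (u : Completion W₁) : (VOAHom.id c W₁).completion c u = u := rfl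

theorem VOAHom.ext_toLinearMap {f g : VOAHom c W₁ W₂} (h : f.toLinearMap = g.toLinearMap) :
    f = g := by
  cases f; cases g; congr

/-- This is the converse of `VOAHom.ofUVir`. The algebra `U(vir)` is generated by the `Lₙ`, which
are modes of the conformal vector, and by `C`, which acts by the same scalar `c` on both modules. -/
theorem VOAHom.map_smul_uvir (f : VOAHom c W₁ W₂) (u : UVir) (w : W₁) :
    f.toLinearMap (u • w) = u • f.toLinearMap w := by
  refine uvir_induction (p := fun u => f.toLinearMap (u • w) = u • f.toLinearMap w)
    ?_ ?_ ?_ ?_ ?_ u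
  · intro n u hu
    rw [mul_smul, mul_smul, ← hu]
    exact f.map_Lop c n _
  · intro u hu
    rw [mul_smul, mul_smul, ← hu, IsSmoothVir.central (c := c), IsSmoothVir.central (c := c),
      map_smul]
  · rw [one_smul, one_smul]
  · intro u v hu hv; rw [add_smul, add_smul, map_add, hu, hv]
  · intro a u hu; rw [smul_assoc, smul_assoc, map_smul, hu]

end Intertwining

/-! ### Highest weight vectors of the first-row modules -/

theorem SimpleQuotient.exists_smul_hw (c h : ℂ) (w : SimpleQuotient c h) :
    ∃ u : UVir, u • SimpleQuotient.hw c h = w := by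
  obtain ⟨x, rfl⟩ := Submodule.Quotient.mk_surjective (maxProper c h) w
  obtain ⟨u, rfl⟩ := Submodule.Quotient.mk_surjective _ x
  exact ⟨u, smul_hw c h u⟩

theorem hwVector_mem_weightSpace (t : ℂ) (l : ℕ) :
    hwVector t l ∈ weightSpace (FirstRow t l) (kacWeight t l) := by
  rw [Module.End.mem_eigenspace_iff, Lop_apply]
  have := smul_hw_eq_zero (centralCharge t) (kacWeight t l)
    (uL 0 - algebraMap ℂ UVir (kacWeight t l)) (Submodule.subset_span (Or.inl (Or.inr rfl)))
  rwa [sub_smul, algebraMap_smul, sub_eq_zero] at this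

/-! ### Consequences of the irrationality of `t` -/

/-- These inequalities give `s ≤ l₁` and `s ≤ l₂` for `s = (l₁ + l₂ - l) / 2`, and they make the
truncated subtraction in `s` a true one. -/
theorem Sel_triangle {l₁ l₂ l : ℕ} (hl : l ∈ Sel l₁ l₂) :
    l ≤ l₁ + l₂ ∧ l₁ ≤ l₂ + l ∧ l₂ ≤ l₁ + l := by
  rw [Sel, Finset.mem_filter, Finset.mem_range, abs_le] at hl
  omega

theorem irrational_combination {t : ℂ} (ht : ∀ r : ℚ, t ≠ (r : ℂ)) {a b : ℚ} (ha : a ≠ 0) :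
    (a : ℂ) * t ≠ b := by
  intro h
  have ha' : (a : ℂ) ≠ 0 := by exact_mod_cast ha
  refine ht (b / a) ?_
  rw [Rat.cast_div, eq_div_iff ha', mul_comm, h]

/-- The Gamma function has no zeros, so only the default value `0` of `Complex.Gamma` at the poles
`0, -1, -2, …` has to be excluded. A pole at `-m` would make `a * t = -m - b` rational. -/
theorem Gamma_ne_zero_of_irrational {t : ℂ} (ht : ∀ r : ℚ, t ≠ (r : ℂ)) {a : ℚ} (ha : a ≠ 0)
    (b : ℕ) : Complex.Gamma (b + a * t) ≠ 0 := by
  refine Complex.Gamma_ne_zero fun m h => irrational_combination ht (b := -m - b) ha ?_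
  push_cast
  linear_combination h

/-- Every Gamma argument in the product is `1` or `2` plus a nonzero integer multiple of `t`. The
multiples are nonzero because `1 ≤ j ≤ s ≤ min l₁ l₂`. This nonvanishing is what lets the tensor
product operator reach each `w_ℓ`. -/
theorem normConst_ne_zero {t : ℂ} (ht : ∀ r : ℚ, t ≠ (r : ℂ)) {l₁ l₂ l : ℕ}
    (hl : l ∈ Sel l₁ l₂) : normConst t l₁ l₂ l ≠ 0 := by
  have hb := Sel_triangle hl
  rw [normConst]
  set s := (l₁ + l₂ - l) / 2
  have hs : s ≤ l₁ ∧ s ≤ l₂ := by omega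
  refine mul_ne_zero (one_div_ne_zero (by exact_mod_cast s.factorial_ne_zero)) ?_
  refine Finset.prod_ne_zero_iff.2 fun j hj => ?_
  rw [Finset.mem_Icc] at hj
  have key : ∀ (z : ℂ) (b : ℕ) (a : ℤ), a ≠ 0 → z = b + ((a : ℚ) : ℂ) * t →
      Complex.Gamma z ≠ 0 := fun z b a ha e => by
    rw [e]; exact Gamma_ne_zero_of_irrational ht (by exact_mod_cast ha) b
  -- The denominators matter too: at a pole `Complex.Gamma` is `0`, and division by `0` would make
  -- the factor vanish.
  refine div_ne_zero (mul_ne_zero (mul_ne_zero ?_ ?_) ?_) (mul_ne_zero ?_ ?_)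
  · exact key _ 1 j (by omega) (by push_cast; ring)
  · exact key _ 1 (-(l₁ + 1 - j)) (by omega) (by push_cast; ring)
  · exact key _ 1 (-(l₂ + 1 - j)) (by omega) (by push_cast; ring)
  · exact key _ 1 1 (by omega) (by push_cast; ring)
  -- Since `j ≤ s` and `s ≤ l₁, l₂`, the integer `2 - j + l₁ + l₂ - s` is at least `2`.
  · exact key _ 2 (-(2 - j + l₁ + l₂ - s)) (by omega) (by push_cast; ring)

/-- The reason is the factorization `h_ℓ - h_ℓ' = (ℓ - ℓ')(ℓ + ℓ' + 2)/4 · t - (ℓ - ℓ')/2`, whose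
coefficient of `t` is a nonzero rational number. This separates the summands of the tensor product
by weight. -/
theorem kacWeight_ne_add_nat {t : ℂ} (ht : ∀ r : ℚ, t ≠ (r : ℂ)) {l l' : ℕ} (hl : l ≠ l')
    (k : ℕ) : kacWeight t l ≠ kacWeight t l' + k := by
  intro h
  have ha : ((l : ℚ) - l') * (l + l' + 2) / 4 ≠ 0 := by
    refine div_ne_zero (mul_ne_zero (sub_ne_zero.2 (by exact_mod_cast hl)) ?_) (by norm_num)
    positivity
  refine irrational_combination ht (b := (l - l') / 2 + k) ha ?_
  rw [kacWeight, kacWeight] at h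
  push_cast
  linear_combination h

/-! ### The tensor product operator on highest weight vectors -/

theorem tensorOp_apply (t : ℂ) (l₁ l₂ : ℕ) (𝒴 : (l : Sel l₁ l₂) →
      Intertwiners (centralCharge t) (FirstRow t l₁) (FirstRow t l₂) (FirstRow t l)) (n : ℂ)
    (w₁ : FirstRow t l₁) (w₂ : FirstRow t l₂) :
    (tensorOp t l₁ l₂ 𝒴).1 n w₁ w₂ =
      ∑ l, (tensorIncl t l₁ l₂ l).toLinearMap ((𝒴 l).1 n w₁ w₂) := by
  rw [tensorOp, Submodule.coe_sum, Finset.sum_apply, LinearMap.sum_apply, LinearMap.sum_apply]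
  rfl

/-- The component of weight `h_ℓ` of `𝒴_⊠(w_{ℓ₁}, e^ζ) w_{ℓ₂}` is a multiple of `w_ℓ`. -/
theorem evalAt_tensorOp_hwVector {t : ℂ} (ht : ∀ r : ℚ, t ≠ (r : ℂ)) {l₁ l₂ : ℕ}
    {𝒴 : (l : Sel l₁ l₂) →
      Intertwiners (centralCharge t) (FirstRow t l₁) (FirstRow t l₂) (FirstRow t l)}
    (h𝒴 : ∀ l : Sel l₁ l₂, IsNormalized t l₁ l₂ l (𝒴 l)) (ζ : ℂ) (l : Sel l₁ l₂) :
    (evalAt (centralCharge t) (tensorOp t l₁ l₂ 𝒴) ζ (hwVector t l₁) (hwVector t l₂)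
        (kacWeight t l) : TensorObj t l₁ l₂) =
      (Complex.exp ((kacWeight t l - kacWeight t l₁ - kacWeight t l₂) * ζ) *
        normConst t l₁ l₂ l) • (tensorIncl t l₁ l₂ l).toLinearMap (hwVector t l) := by
  rw [evalAt_of_mem_weightSpace _ _ (hwVector_mem_weightSpace t l₁)
    (hwVector_mem_weightSpace t l₂), tensorOp_apply, Finset.sum_eq_single l, (h𝒴 l).1, map_smul,
    smul_smul]
  · intro l' _ hne
    -- By normalization the exponents of `𝒴^{ℓ'}` on the highest weight vectors lie in `h_ℓ' -
    -- h_{ℓ₁} - h_{ℓ₂} + ℕ`. Weight `h_ℓ` corresponds to the exponent `h_ℓ - h_{ℓ₁} - h_{ℓ₂}`, which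
    -- is not among them.
    rw [(h𝒴 l').2, map_zero]
    intro k e
    refine kacWeight_ne_add_nat ht (fun e => hne (Subtype.ext e.symm)) k (l' := l') (l := l) ?_
    linear_combination e
  · intro h
    exact absurd (Finset.mem_univ l) h

/-! ### The logarithm continued along the path -/

/-- The end point of the lift lies over the end point of the reversed path, which is `z₁`. -/
theorem exp_logAlong {z₁ z₂ : {z : ℂ // z ≠ 0}} (γ : Path z₁ z₂) :
    Complex.exp (logAlong γ) = z₁ := by
  have h := congrFun (Complex.isCoveringMap_exp.liftPath_lifts
    (γ.symm : C(unitInterval, {z : ℂ // z ≠ 0})) (logBranch z₂) (Subtype.ext (by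
      change (γ.symm 0 : {z : ℂ // z ≠ 0}).1 = _
      rw [γ.symm.source]
      exact (exp_logBranch z₂.2).symm))) 1
  have h' := congrArg Subtype.val h
  refine h'.trans ?_
  change (γ.symm 1 : {z : ℂ // z ≠ 0}).1 = _
  rw [γ.symm.target]

theorem logAlong_eq_logBranch {z₁ z₂ : {z : ℂ // z ≠ 0}} (γ : Path z₁ z₂)
    (hγ : (logAlong γ).im = toIcoMod Real.two_pi_pos 0 (z₁ : ℂ).arg) :
    logAlong γ = logBranch z₁ := by
  refine Complex.ext ?_ hγ
  change _ = Real.log ‖(z₁ : ℂ)‖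
  -- All logarithms of `z₁` have the same real part, because `‖exp ζ‖ = exp (re ζ)`; only the
  -- imaginary part depends on the branch.
  rw [← exp_logAlong γ, Complex.norm_exp, Real.log_exp]

/-! ### Rigidity of endomorphisms and the parallel transport -/

/-- Each summand is cyclic over `U(vir)` with generator `w_ℓ`, and both the endomorphism and the
inclusions commute with `U(vir)`. -/
theorem VOAHom.eq_id_of_tensorIncl_hwVector {t : ℂ} {l₁ l₂ : ℕ}
    (f : VOAHom (centralCharge t) (TensorObj t l₁ l₂) (TensorObj t l₁ l₂))
    (h : ∀ l : Sel l₁ l₂, f.toLinearMap ((tensorIncl t l₁ l₂ l).toLinearMap (hwVector t l)) =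
      (tensorIncl t l₁ l₂ l).toLinearMap (hwVector t l)) :
    f = VOAHom.id (centralCharge t) (TensorObj t l₁ l₂) := by
  refine VOAHom.ext_toLinearMap _ (DirectSum.linearMap_ext ℂ fun l => LinearMap.ext fun w => ?_)
  obtain ⟨u, rfl⟩ := SimpleQuotient.exists_smul_hw _ _ w
  change f.toLinearMap ((tensorIncl t l₁ l₂ l).toLinearMap (u • hwVector t l)) =
    (tensorIncl t l₁ l₂ l).toLinearMap (u • hwVector t l)
  rw [VOAHom.map_smul_uvir, VOAHom.map_smul_uvir, h]

end FirstRowVirasoro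

end

theorem mainTheorem9 (t : ℂ) (ht : ∀ r : ℚ, t ≠ (r : ℂ)) (l₁ l₂ : ℕ)
    (𝒴 : (l : Sel l₁ l₂) →
      Intertwiners (centralCharge t) (FirstRow t l₁) (FirstRow t l₂) (FirstRow t l))
    (h𝒴 : ∀ l : Sel l₁ l₂, IsNormalized t l₁ l₂ l (𝒴 l))
    (z₁ z₂ : {z : ℂ // z ≠ 0}) (γ : Path z₁ z₂)
    (hγ : (logAlong γ).im = toIcoMod Real.two_pi_pos 0 (z₁ : ℂ).arg) :
    ∃ T : VOAHom (centralCharge t) (TensorObj t l₁ l₂) (TensorObj t l₁ l₂),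
      (∀ T' : VOAHom (centralCharge t) (TensorObj t l₁ l₂) (TensorObj t l₁ l₂),
        IsParallelTransport (centralCharge t) γ
          (tensorOp t l₁ l₂ 𝒴) (tensorOp t l₁ l₂ 𝒴) T' ↔ T' = T) ∧
      ∀ (l : Sel l₁ l₂) (w : FirstRow t l),
        T.toLinearMap ((tensorIncl t l₁ l₂ l).toLinearMap w) =
          (tensorIncl t l₁ l₂ l).toLinearMap w := by
  have hlog := logAlong_eq_logBranch γ hγ
  refine ⟨VOAHom.id _ _, fun T' => ⟨fun hT => ?_, ?_⟩, fun _ _ => rfl⟩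
  · refine VOAHom.eq_id_of_tensorIncl_hwVector T' fun l => ?_
    -- The extension to completions acts weight by weight, so the transport equation may be read in
    -- weight `h_ℓ` alone; the pair of highest weight vectors suffices.
    have h := congrArg Subtype.val
      (congrFun (hT (hwVector t l₁) (hwVector t l₂)) (kacWeight t l))
    have e := evalAt_tensorOp_hwVector ht h𝒴 (logBranch z₁) l
    rw [hlog, e] at h
    -- The left side of `h` is by definition `T'` applied to the weight `h_ℓ` component, and `e`
    -- identifies that component. The result is that `T'` fixes a scalar multiple of `w_ℓ`; the
    -- scalar, an exponential times `normConst`, is then cancelled.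
    replace h := (congrArg T'.toLinearMap e).symm.trans h
    rw [map_smul] at h
    exact smul_right_injective _ (mul_ne_zero (Complex.exp_ne_zero _)
      (normConst_ne_zero ht l.2)) h
  · rintro rfl w₁ w₂
    -- With equal logarithms both sides are the same evaluation of `𝒴_⊠`.
    rw [VOAHom.completion_id, hlog]
    rfl
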